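/- **Setting.** Let $\mathcal K$ be a complex Hilbert space of finite or infinite dimension. A *state* on $\mathcal K$ is a positive trace class operator with trace one. Let $\rho,\sigma$ be states with spectral decompositions $$\rho=\sum_{i\in I} r_i\,|u_i\rangle\langle u_i|,\qquad \sigma=\sum_{j\in I}s_j\,|v_j\rangle\langle v_j|,$$ where $(u_i)_{i\in I}$ and $(v_j)_{j\in I}$ are orthonormal bases of $\mathcal K$, $r_i,s_j\ge 0$ and $\sum_i r_i=\sum_j s_j=1$. Their Nussbaum–Szkoła distributions are the probability distributions on $I\times I$ $$P(i,j)=r_i|\langle u_i,v_j\rangle|^2,\qquad Q(i,j)=s_j|\langle u_i,v_j\rangle|^2 .$$ For a convex or concave $f:(0,\infty)\to\mathbb R$ put $f(0)=\lim_{t\downarrow0}f(t)$ and $f'(\infty)=\lim_{t\to\infty}f(t)/t$, both in $[-\infty,\infty]$, with the conventions $0\cdot(\pm\infty)=0$, $0f(0/0)=0$ and $0f(a/0)=a f'(\infty)$ for $a>0$. The classical $f$-divergence is $$D_f(P\|Q)=\sum_{(i,j)\in I\times I}Q(i,j)\,f\!\left(\frac{P(i,j)}{Q(i,j)}\right)\in[-\infty,\infty].$$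 Let $\mathcal B_2(\mathcal K)$ be the Hilbert space of Hilbert–Schmidt operators with $\langle A,B\rangle_2=\operatorname{tr}(A^\dagger B)$, let $\Pi_\eta$ be the orthogonal projection onto the support $(\ker\eta)^\perp$ of a state $\eta$, and $\Pi_\eta^\perp=1-\Pi_\eta$. Let $S$ be the densely defined closable antilinear operator on $\mathcal B_2(\mathcal K)$ with $$S\big(X\sqrt\sigma+Y(1-\Pi_\sigma)\big)=\Pi_\sigma X^\dagger\sqrt\rho,\qquad X\in\mathcal B(\mathcal K),\ Y\in\mathcal B_2(\mathcal K),$$ let $\Delta_{\rho,\sigma}=S^\dagger\overline S$ be the relative modular operator (a positive self-adjoint operator), and $\xi^{\Delta_{\rho,\sigma}}$ its spectral measure. The quantum $f$-divergence is $$D_f(\rho\|\sigma)=\int_{(0,\infty)}f(\lambda)\,\langle\sqrt\sigma,\xi^{\Delta_{\rho,\sigma}}(d\lambda)\sqrt\sigma\rangle_2+f(0)\operatorname{tr}(\sigma\Pi_\rho^\perp)+f'(\infty)\operatorname{tr}(\rho\Pi_\sigma^\perp)\in[-\infty,\infty].$$ **Theorem.** For all states $\rho,\sigma$ with spectral decompositions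 as above and every convex or concave $f:(0,\infty)\to\mathbb R$, $$D_f(\rho\|\sigma)=D_f(P\|Q).$$ -/

import Mathlib

noncomputable section

open MeasureTheory Filter Topology Set
open scoped InnerProductSpace ENNReal

namespace NussbaumSzkola

/-! ### Extended-real valued integrals and sums -/

/-- The integral of an extended-real valued function, `∫ g⁺ - ∫ g⁻`.  It has its usual meaning
as soon as one of the two parts has a finite integral. -/
def erealIntegral {α : Type*} [MeasurableSpace α] (μ : Measure α) (g : α → EReal) : EReal :=
  ((∫⁻ a, (g a).toENNReal ∂μ : ℝ≥0∞) : EReal) - ((∫⁻ a, (-(g a)).toENNReal ∂μ : ℝ≥0∞) : EReal)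

/-- The unordered sum of a family of extended reals, `∑ g⁺ - ∑ g⁻`.  It has its usual meaning
as soon as one of the two parts has a finite sum. -/
def erealSum {α : Type*} (g : α → EReal) : EReal :=
  ((∑' a, (g a).toENNReal : ℝ≥0∞) : EReal) - ((∑' a, (-(g a)).toENNReal : ℝ≥0∞) : EReal)

/-! ### Boundary values of a function on `(0, ∞)`

A function `f : (0, ∞) → ℝ` is given by a function on `ℝ` whose values outside `(0, ∞)`
are never used. -/

/-- `f(0) = lim_{t ↓ 0} f(t)`, in `[-∞, ∞]`. -/
def valueAtZero (f : ℝ → ℝ) : EReal := limUnder (𝓝[>] (0 : ℝ)) (fun t => (f t : EReal))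

/-- `f'(∞) = lim_{t → ∞} f(t) / t`, in `[-∞, ∞]`. -/
def slopeAtInfty (f : ℝ → ℝ) : EReal := limUnder atTop (fun t : ℝ => ((f t / t : ℝ) : EReal))

/-! ### Classical `f`-divergence of discrete distributions -/

/-- The term `q f(p / q)` for `p, q ≥ 0`, with the conventions `0 f(0/0) = 0`,
`0 f(p/0) = p f'(∞)` for `p > 0`, and `f(0) = lim_{t ↓ 0} f(t)`. -/
def divergenceTerm (f : ℝ → ℝ) (p q : ℝ) : EReal :=
  if q = 0 then (if p = 0 then 0 else (p : EReal) * slopeAtInfty f)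
  else if p = 0 then (q : EReal) * valueAtZero f
  else (q : EReal) * (f (p / q) : EReal)

/-- The `f`-divergence `D_f(P‖Q) = ∑ Q(a) f(P(a) / Q(a))` of discrete distributions. -/
def classicalFDivergence {α : Type*} (f : ℝ → ℝ) (P Q : α → ℝ) : EReal :=
  erealSum (fun a => divergenceTerm f (P a) (Q a))

/-! ### Projection-valued measures on the real line -/

section PVM

variable (H : Type*) [NormedAddCommGroup H] [InnerProductSpace ℂ H] [CompleteSpace H]

/-- A projection-valued measure on the Borel sets of `ℝ`: orthogonal projections, countably
additive in the strong operator topology, with total mass the identity.  The values on sets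
that are not Borel play no role. -/
structure ProjectionValuedMeasure where
  proj : Set ℝ → H →L[ℂ] H
  isStarProjection : ∀ E, MeasurableSet E → IsStarProjection (proj E)
  proj_univ : proj univ = 1
  hasSum_iUnion : ∀ E : ℕ → Set ℝ, (∀ n, MeasurableSet (E n)) → Pairwise (Function.onFun Disjoint E) →
    ∀ x : H, HasSum (fun n => proj (E n) x) (proj (⋃ n, E n) x)

variable {H}

theorem ProjectionValuedMeasure.re_inner_nonneg (ξ : ProjectionValuedMeasure H) {E : Set ℝ}
    (hE : MeasurableSet E) (x : H) : 0 ≤ (⟪x, ξ.proj E x⟫_ℂ).re := by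
  have h := ξ.isStarProjection E hE
  have h1 : ξ.proj E x = ξ.proj E (ξ.proj E x) := by
    conv_lhs => rw [← h.isIdempotentElem.eq]
    rfl
  have h2 : ⟪x, ξ.proj E x⟫_ℂ = ⟪ξ.proj E x, ξ.proj E x⟫_ℂ := by
    conv_lhs => rw [h1]
    rw [← ContinuousLinearMap.adjoint_inner_left, ← ContinuousLinearMap.star_eq_adjoint,
      h.isSelfAdjoint.star_eq]
  rw [h2]
  exact inner_self_nonneg (𝕜 := ℂ)

theorem ProjectionValuedMeasure.proj_empty (ξ : ProjectionValuedMeasure H) (x : H) :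
    ξ.proj ∅ x = 0 := by
  have h := ξ.hasSum_iUnion (fun _ => ∅) (fun _ => MeasurableSet.empty)
    (fun _ _ _ => disjoint_bot_left) x
  exact tendsto_nhds_unique tendsto_const_nhds h.summable.tendsto_atTop_zero

/-- The scalar measure `E ↦ ⟨x, ξ(E) x⟩` of a projection-valued measure. -/
def ProjectionValuedMeasure.scalarMeasure (ξ : ProjectionValuedMeasure H) (x : H) : Measure ℝ :=
  Measure.ofMeasurable (fun E _ => ENNReal.ofReal (⟪x, ξ.proj E x⟫_ℂ).re)
    (by simp [ξ.proj_empty])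
    (by
      intro E hE hd
      have h := ξ.hasSum_iUnion E hE hd x
      have h2 : HasSum (fun n => (⟪x, ξ.proj (E n) x⟫_ℂ).re)
          (⟪x, ξ.proj (⋃ n, E n) x⟫_ℂ).re :=
        Complex.hasSum_re (h.mapL (innerSL ℂ x))
      rw [← h2.tsum_eq]
      exact ENNReal.ofReal_tsum_of_nonneg (fun n => ξ.re_inner_nonneg (hE n) x) h2.summable)

/-- `ξ` is the spectral measure of the operator with graph `G`, i.e. `G` is the graph of
`∫ t dξ(t)`: a vector `x` lies in the domain iff `∫ t² d⟨x, ξ(t) x⟩ < ∞`, and then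
`⟨x, A x⟩ = ∫ t d⟨x, ξ(t) x⟩`.  (The off-diagonal matrix elements follow by polarization.) -/
structure IsSpectralMeasure (ξ : ProjectionValuedMeasure H) (G : Set (H × H)) : Prop where
  mem_domain_iff : ∀ x : H,
    (∃ y, (x, y) ∈ G) ↔ ∫⁻ t, ENNReal.ofReal (t ^ 2) ∂(ξ.scalarMeasure x) < ∞
  inner_eq_integral : ∀ x y : H, (x, y) ∈ G →
    ⟪x, y⟫_ℂ = ((∫ t, t ∂(ξ.scalarMeasure x) : ℝ) : ℂ)

/-- The projection-valued Dirac measure at `0`. -/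
instance : Nonempty (ProjectionValuedMeasure H) := by
  classical
  refine ⟨⟨fun E => if (0 : ℝ) ∈ E then 1 else 0, ?_, by simp, ?_⟩⟩
  · intro E _
    split_ifs
    · exact IsStarProjection.one _
    · exact IsStarProjection.zero _
  · intro E _ hd x
    by_cases h : (0 : ℝ) ∈ ⋃ n, E n
    · obtain ⟨n, hn⟩ := mem_iUnion.1 h
      simp only [h, if_true]
      have : (if (0 : ℝ) ∈ E n then (1 : H →L[ℂ] H) else 0) x = (1 : H →L[ℂ] H) x := by
        simp [hn]
      rw [← this]
      refine hasSum_single n fun m hm => ?_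
      have : (0 : ℝ) ∉ E m := fun h0 => Set.disjoint_left.1 (hd hm) h0 hn
      simp [this]
    · have h' : ∀ n, (0 : ℝ) ∉ E n := fun n hn => h (mem_iUnion.2 ⟨n, hn⟩)
      simp only [h, h', if_false]
      exact hasSum_zero

/-- The spectral measure of the self-adjoint operator with graph `G`.  (For a self-adjoint
operator it exists and is unique by the spectral theorem; for other `G` the value is
arbitrary.) -/
def spectralMeasure (G : Set (H × H)) : ProjectionValuedMeasure H :=
  Classical.epsilon (fun ξ => IsSpectralMeasure ξ G)

end PVM

/-! ### Hilbert–Schmidt operators and traces -/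

variable (K : Type*) [NormedAddCommGroup K] [InnerProductSpace ℂ K] [CompleteSpace K]

/-- The index set of a fixed orthonormal basis of `K`. -/
def StdIndex : Set K := (exists_hilbertBasis ℂ K).choose

/-- A fixed orthonormal basis of `K`.  The Hilbert–Schmidt inner product and the trace are
computed in it; they do not depend on the choice of the basis. -/
def stdBasis : HilbertBasis (StdIndex K) ℂ K := (exists_hilbertBasis ℂ K).choose_spec.choose

/-- The subspace of those bounded operators `A` with `∑ ‖A bᵢ‖² < ∞`. -/
def hilbertSchmidtSubmodule : Submodule ℂ (K →L[ℂ] K) where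
  carrier := {A | Summable fun i => ‖A (stdBasis K i)‖ ^ 2}
  zero_mem' := by simp [summable_zero]
  add_mem' := by
    intro A B hA hB
    refine Summable.of_nonneg_of_le (fun i => by positivity) (fun i => ?_)
      ((hA.add hB).mul_left 2)
    have h := norm_add_le (A (stdBasis K i)) (B (stdBasis K i))
    have h0 := norm_nonneg (A (stdBasis K i) + B (stdBasis K i))
    simp only [add_apply]
    nlinarith [sq_nonneg (‖A (stdBasis K i)‖ - ‖B (stdBasis K i)‖)]
  smul_mem' := by
    intro c A hA
    have : (fun i => ‖(c • A) (stdBasis K i)‖ ^ 2)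
        = fun i => ‖c‖ ^ 2 * ‖A (stdBasis K i)‖ ^ 2 := by
      funext i
      simp [norm_smul, mul_pow]
    change Summable fun i => ‖(c • A) (stdBasis K i)‖ ^ 2
    rw [this]
    exact Summable.mul_left _ hA

/-- The space `B₂(K)` of Hilbert–Schmidt operators on `K`. -/
@[ext]
structure HilbertSchmidt where
  op : K →L[ℂ] K
  mem : op ∈ hilbertSchmidtSubmodule K

variable {K}

namespace HilbertSchmidt

theorem op_injective : Function.Injective (op : HilbertSchmidt K → K →L[ℂ] K) :=
  fun _ _ h => HilbertSchmidt.ext h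

instance : Zero (HilbertSchmidt K) := ⟨⟨0, Submodule.zero_mem _⟩⟩
instance : Add (HilbertSchmidt K) := ⟨fun A B => ⟨A.op + B.op, Submodule.add_mem _ A.mem B.mem⟩⟩
instance : Neg (HilbertSchmidt K) := ⟨fun A => ⟨-A.op, Submodule.neg_mem _ A.mem⟩⟩
instance : Sub (HilbertSchmidt K) := ⟨fun A B => ⟨A.op - B.op, Submodule.sub_mem _ A.mem B.mem⟩⟩
instance : SMul ℂ (HilbertSchmidt K) := ⟨fun c A => ⟨c • A.op, Submodule.smul_mem _ c A.mem⟩⟩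
instance : SMul ℕ (HilbertSchmidt K) := ⟨fun n A => ⟨n • A.op, nsmul_mem A.mem n⟩⟩
instance : SMul ℤ (HilbertSchmidt K) := ⟨fun n A => ⟨n • A.op, zsmul_mem A.mem n⟩⟩

instance : AddCommGroup (HilbertSchmidt K) :=
  op_injective.addCommGroup op rfl (fun _ _ => rfl) (fun _ => rfl) (fun _ _ => rfl)
    (fun _ _ => rfl) (fun _ _ => rfl)

/-- The inclusion of `B₂(K)` into the bounded operators, as an additive map. -/
def opHom : HilbertSchmidt K →+ (K →L[ℂ] K) where
  toFun := op
  map_zero' := rfl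
  map_add' _ _ := rfl

instance : Module ℂ (HilbertSchmidt K) :=
  op_injective.module ℂ opHom (fun _ _ => rfl)

/-- The square-summable family `(A bᵢ)ᵢ`. -/
def toLp (A : HilbertSchmidt K) : lp (fun _ : StdIndex K => K) 2 :=
  ⟨fun i => A.op (stdBasis K i), by
    refine memℓp_gen ?_
    have h : Summable fun i => ‖A.op (stdBasis K i)‖ ^ 2 := A.mem
    simpa using h⟩

theorem summable_inner (A B : HilbertSchmidt K) :
    Summable fun i => ⟪A.op (stdBasis K i), B.op (stdBasis K i)⟫_ℂ :=
  lp.summable_inner (𝕜 := ℂ) A.toLp B.toLp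

/-- The Hilbert–Schmidt inner product `⟨A, B⟩₂ = tr(A† B) = ∑ ⟨A bᵢ, B bᵢ⟩`. -/
instance : Inner ℂ (HilbertSchmidt K) :=
  ⟨fun A B => ∑' i, ⟪A.op (stdBasis K i), B.op (stdBasis K i)⟫_ℂ⟩

theorem inner_def (A B : HilbertSchmidt K) :
    ⟪A, B⟫_ℂ = ∑' i, ⟪A.op (stdBasis K i), B.op (stdBasis K i)⟫_ℂ := rfl

theorem inner_eq_toLp (A B : HilbertSchmidt K) : ⟪A, B⟫_ℂ = ⟪A.toLp, B.toLp⟫_ℂ := rfl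

theorem toLp_add (A B : HilbertSchmidt K) : (A + B).toLp = A.toLp + B.toLp := rfl

theorem toLp_sub (A B : HilbertSchmidt K) : (A - B).toLp = A.toLp - B.toLp := rfl

theorem toLp_smul (c : ℂ) (A : HilbertSchmidt K) : (c • A).toLp = c • A.toLp := rfl

/-- An operator is bounded by its Hilbert–Schmidt norm. -/
theorem norm_op_apply_le (A : HilbertSchmidt K) (y : K) : ‖A.op y‖ ≤ ‖A.toLp‖ * ‖y‖ := by
  have h1 : HasSum (fun i => (stdBasis K).repr y i • A.op (stdBasis K i)) (A.op y) := by
    simpa using ((stdBasis K).hasSum_repr y).mapL A.op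
  refine le_of_tendsto h1.norm (Eventually.of_forall fun s => ?_)
  have hA : ∑ i ∈ s, ‖A.op (stdBasis K i)‖ ^ 2 ≤ ‖A.toLp‖ ^ 2 := by
    have h := lp.sum_rpow_le_norm_rpow (p := 2) (by simp) A.toLp s
    simp only [ENNReal.toReal_ofNat, Real.rpow_ofNat] at h
    exact h
  have hy : ∑ i ∈ s, ‖(stdBasis K).repr y i‖ ^ 2 ≤ ‖y‖ ^ 2 := by
    simpa [HilbertBasis.repr_apply_apply] using
      (stdBasis K).orthonormal.sum_inner_products_le y (s := s)
  refine (norm_sum_le _ _).trans ?_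
  refine abs_le_of_sq_le_sq' ?_ (by positivity) |>.2
  simp only [norm_smul]
  refine (Finset.sum_mul_sq_le_sq_mul_sq s _ _).trans ?_
  rw [mul_pow, mul_comm]
  gcongr

theorem toLp_injective : Function.Injective (toLp : HilbertSchmidt K → _) := by
  intro A B h
  have h0 : (A - B).toLp = 0 := by rw [toLp_sub, h, sub_self]
  refine op_injective (ContinuousLinearMap.ext fun y => ?_)
  have := norm_op_apply_le (A - B) y
  rw [h0, norm_zero, zero_mul] at this
  exact sub_eq_zero.1 (norm_le_zero_iff.1 this)

/-- The axioms of the Hilbert–Schmidt inner product. -/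
@[reducible]
def core : InnerProductSpace.Core ℂ (HilbertSchmidt K) where
  inner A B := ⟪A, B⟫_ℂ
  conj_inner_symm A B := inner_conj_symm A.toLp B.toLp
  re_inner_nonneg A := inner_self_nonneg (𝕜 := ℂ) (x := A.toLp)
  add_left A B C := inner_add_left A.toLp B.toLp C.toLp
  smul_left A B c := inner_smul_left A.toLp B.toLp c
  definite A h := toLp_injective (inner_self_eq_zero.1 (h : ⟪A.toLp, A.toLp⟫_ℂ = 0))

instance : NormedAddCommGroup (HilbertSchmidt K) :=
  InnerProductSpace.Core.toNormedAddCommGroup (cd := core)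

instance : InnerProductSpace ℂ (HilbertSchmidt K) := InnerProductSpace.ofCore core.toCore

theorem norm_eq (A : HilbertSchmidt K) : ‖A‖ = ‖A.toLp‖ := by
  rw [norm_eq_sqrt_re_inner (𝕜 := ℂ) A.toLp]
  exact norm_eq_sqrt_re_inner (𝕜 := ℂ) A

theorem isometry_toLp : Isometry (toLp : HilbertSchmidt K → _) :=
  Isometry.of_dist_eq fun A B => by rw [dist_eq_norm, dist_eq_norm, ← toLp_sub, norm_eq]

instance : CompleteSpace (HilbertSchmidt K) := by
  refine Metric.complete_of_cauchySeq_tendsto fun u hu => ?_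
  obtain ⟨x, hx⟩ := cauchySeq_tendsto_of_complete
    (isometry_toLp.uniformContinuous.comp_cauchySeq hu)
  have hl : LipschitzWith 1 (op : HilbertSchmidt K → K →L[ℂ] K) := by
    refine LipschitzWith.of_dist_le_mul fun A B => ?_
    rw [dist_eq_norm, dist_eq_norm, norm_eq, NNReal.coe_one, one_mul]
    exact ContinuousLinearMap.opNorm_le_bound _ (norm_nonneg _) (norm_op_apply_le (A - B))
  obtain ⟨A, hA⟩ := cauchySeq_tendsto_of_complete (hl.uniformContinuous.comp_cauchySeq hu)
  have hAx : ∀ i, A (stdBasis K i) = x i := by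
    intro i
    refine tendsto_nhds_unique (f := fun n => (u n).op (stdBasis K i)) (l := atTop) ?_ ?_
    · exact ((ContinuousLinearMap.apply ℂ K (stdBasis K i)).continuous.tendsto A).comp hA
    · have h1 : Tendsto (fun n => (⇑(u n).toLp : StdIndex K → K)) atTop (𝓝 ⇑x) :=
        (lp.uniformContinuous_coe (p := 2)).continuous.continuousAt.tendsto.comp hx
      exact (tendsto_pi_nhds.1 h1) i
  have hm : A ∈ hilbertSchmidtSubmodule K := by
    have h := (lp.memℓp x).summable (by simp)
    change Summable fun i => ‖A (stdBasis K i)‖ ^ 2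
    simpa [hAx] using h
  refine ⟨⟨A, hm⟩, ?_⟩
  have hxA : toLp ⟨A, hm⟩ = x := by
    ext i
    exact hAx i
  rw [isometry_toLp.isEmbedding.tendsto_nhds_iff, hxA]
  exact hx

end HilbertSchmidt

/-- The trace `∑ ⟨bᵢ, A bᵢ⟩`. It is used for trace class operators only. -/
def trace (A : K →L[ℂ] K) : ℂ := ∑' i, ⟪stdBasis K i, A (stdBasis K i)⟫_ℂ

variable (K) in
/-- A state: a positive operator with `∑ ⟨bᵢ, ρ bᵢ⟩ = 1`.  (A positive operator is of trace
class iff this series converges.) -/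
structure DensityOperator where
  op : K →L[ℂ] K
  isPositive : op.IsPositive
  hasSum_one : HasSum (fun i => ⟪stdBasis K i, op (stdBasis K i)⟫_ℂ) 1

namespace DensityOperator

/-- The positive square root `√ρ`. -/
def sqrt (ρ : DensityOperator K) : K →L[ℂ] K := CFC.sqrt ρ.op

/-- `√ρ` is a Hilbert–Schmidt operator. -/
theorem sqrt_mem (ρ : DensityOperator K) : ρ.sqrt ∈ hilbertSchmidtSubmodule K := by
  have h0 : 0 ≤ ρ.op := (ContinuousLinearMap.nonneg_iff_isPositive _).2 ρ.isPositive
  have hs : IsSelfAdjoint ρ.sqrt := IsSelfAdjoint.of_nonneg (CFC.sqrt_nonneg ρ.op)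
  have hsq : ρ.sqrt * ρ.sqrt = ρ.op := CFC.sqrt_mul_sqrt_self ρ.op h0
  have h : ∀ x, (⟪x, ρ.op x⟫_ℂ).re = ‖ρ.sqrt x‖ ^ 2 := by
    intro x
    rw [← hsq, mul_apply_eq_comp, ← ContinuousLinearMap.adjoint_inner_left,
      ← ContinuousLinearMap.star_eq_adjoint, hs.star_eq]
    exact inner_self_eq_norm_sq (𝕜 := ℂ) _
  change Summable fun i => ‖ρ.sqrt (stdBasis K i)‖ ^ 2
  simpa only [h] using (Complex.hasSum_re ρ.hasSum_one).summable

/-- `√ρ` as a vector of `B₂(K)`. -/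
def sqrtHS (ρ : DensityOperator K) : HilbertSchmidt K := ⟨ρ.sqrt, ρ.sqrt_mem⟩

/-- `Π_ρ^⊥`, the orthogonal projection onto `ker ρ`. -/
def kerProj (ρ : DensityOperator K) : K →L[ℂ] K := (ρ.op.ker).starProjection

/-- `Π_ρ`, the orthogonal projection onto the support `(ker ρ)^⊥` of `ρ`. -/
def suppProj (ρ : DensityOperator K) : K →L[ℂ] K := (ρ.op.ker)ᗮ.starProjection

end DensityOperator

/-! ### The relative modular operator

The operators below are given by their graphs in `B₂(K) × B₂(K)`. -/

/-- The graph of the antilinear operator `S` with domain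
`{X √σ + Y (1 - Π_σ) : X ∈ B(K), Y ∈ B₂(K)}`, given by
`S (X √σ + Y (1 - Π_σ)) = Π_σ X† √ρ`. -/
def graphS (ρ σ : DensityOperator K) : Set (HilbertSchmidt K × HilbertSchmidt K) :=
  {p | ∃ (X : K →L[ℂ] K) (Y : HilbertSchmidt K),
    p.1.op = X * σ.sqrt + Y.op * (1 - σ.suppProj) ∧
    p.2.op = σ.suppProj * ContinuousLinearMap.adjoint X * ρ.sqrt}

/-- The graph of the adjoint of the antilinear operator with graph `G`: the pairs `(a, c)` with
`⟨a, S b⟩ = conj ⟨c, b⟩` for all `b` in the domain of `S`. -/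
def antilinearAdjointGraph {H : Type*} [NormedAddCommGroup H] [InnerProductSpace ℂ H]
    (G : Set (H × H)) : Set (H × H) :=
  {q | ∀ p ∈ G, ⟪q.1, p.2⟫_ℂ = starRingEnd ℂ ⟪q.2, p.1⟫_ℂ}

/-- The graph of the relative modular operator `Δ_{ρ,σ} = S† S̄`, where `S̄` is the closure
of `S`. -/
def relativeModularGraph (ρ σ : DensityOperator K) : Set (HilbertSchmidt K × HilbertSchmidt K) :=
  {p | ∃ b, (p.1, b) ∈ closure (graphS ρ σ) ∧ (b, p.2) ∈ antilinearAdjointGraph (graphS ρ σ)}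

/-! ### Quantum `f`-divergence -/

/-- `D_f(ρ‖σ) = ∫_{(0,∞)} f(t) ⟨√σ, ξ(dt) √σ⟩₂ + f(0) tr(σ Π_ρ^⊥) + f'(∞) tr(ρ Π_σ^⊥)`, where `ξ`
is the spectral measure of `Δ_{ρ,σ}`. -/
def quantumFDivergence (f : ℝ → ℝ) (ρ σ : DensityOperator K) : EReal :=
  erealIntegral
      (((spectralMeasure (relativeModularGraph ρ σ)).scalarMeasure σ.sqrtHS).restrict (Ioi 0))
      (fun t => (f t : EReal))
    + valueAtZero f * ((trace (σ.op * ρ.kerProj)).re : EReal)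
    + slopeAtInfty f * ((trace (ρ.op * σ.kerProj)).re : EReal)

/-! ### Nussbaum–Szkoła distributions -/

/-- The spectral decomposition `ρ = ∑ rᵢ |uᵢ⟩⟨uᵢ|`, `rᵢ ≥ 0`, `∑ rᵢ = 1`, in the orthonormal
basis `u`. -/
structure IsSpectralDecomposition {ι : Type*} (ρ : DensityOperator K) (r : ι → ℝ)
    (u : HilbertBasis ι ℂ K) : Prop where
  nonneg : ∀ i, 0 ≤ r i
  hasSum_one : HasSum r 1
  hasSum_apply : ∀ x, HasSum (fun i => (r i : ℂ) • ⟪u i, x⟫_ℂ • u i) (ρ.op x)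

/-- `P(i, j) = rᵢ |⟨uᵢ, vⱼ⟩|²`. -/
def nussbaumSzkolaP {ι : Type*} (r : ι → ℝ) (u v : HilbertBasis ι ℂ K) (a : ι × ι) : ℝ :=
  r a.1 * ‖⟪u a.1, v a.2⟫_ℂ‖ ^ 2

/-- `Q(i, j) = sⱼ |⟨uᵢ, vⱼ⟩|²`. -/
def nussbaumSzkolaQ {ι : Type*} (s : ι → ℝ) (u v : HilbertBasis ι ℂ K) (a : ι × ι) : ℝ :=
  s a.2 * ‖⟪u a.1, v a.2⟫_ℂ‖ ^ 2

end NussbaumSzkola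

end

noncomputable section

open MeasureTheory Filter Topology Set
open scoped InnerProductSpace ENNReal

namespace NussbaumSzkola

/-! ### Expansions in a Hilbert basis -/

section Basis

variable {H : Type*} [NormedAddCommGroup H] [InnerProductSpace ℂ H] {α : Type*}

/-! The rank one operators `|uᵢ⟩⟨vⱼ|` form an orthonormal basis of the Hilbert–Schmidt space that
diagonalizes the relative modular operator. On this basis `S` sends `c |uᵢ⟩⟨vⱼ|` to `√(rᵢ/sⱼ) c̄
|vⱼ⟩⟨uᵢ|`, where `r/0 = 0` accounts for the factor `Π_σ`. Hence `Δ = S†S̄` is the maximal diagonal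
operator with eigenvalues `rᵢ/sⱼ` (`relativeModularGraph_eq`); equality of domains matters, because
the spectral measure is attached to the graph.

The spectral measure is specified only through domains and quadratic forms, and is selected by
choice. A diagonal operator has one, and every candidate has the scalar measures `∑ |⟨eₐ, x⟩|²
δ_{lₐ}` (`IsSpectralMeasure.scalarMeasure_eq`). Since `⟨uᵢ, √σ vⱼ⟩ = √sⱼ ⟨uᵢ, vⱼ⟩`, the vector `√σ`
yields mass `Q(i,j)` at `rᵢ/sⱼ`, which equals `P(i,j)/Q(i,j)` where `Q(i,j) ≠ 0`
(`scalarMeasure_relativeModularGraph`).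

The integral over `(0,∞)` is therefore the part of the classical sum with `rᵢ, sⱼ > 0`. The traces
expand to the `Q`-mass of `rᵢ = 0` and the `P`-mass of `sⱼ = 0` (`hasSum_trace_mul_kerProj`), so the
boundary terms are the remaining parts (`divergenceTerm_cases`). The three parts may be added in
`[-∞, ∞]` because no `∞ - ∞` arises: a convex `f` satisfies `f t ≥ -C (1 + t)` and its boundary
values are not `-∞`, so all negative parts are summable; for concave `f` the signs are reversed. -/

theorem hasSum_norm_inner_sq (e : HilbertBasis α ℂ H) (x : H) :
    HasSum (fun a => ‖⟪e a, x⟫_ℂ‖ ^ 2) (‖x‖ ^ 2) := by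
  have h := Complex.hasSum_re (e.hasSum_inner_mul_inner x x)
  rw [inner_self_eq_norm_sq_to_K] at h
  convert h using 1
  · funext a
    rw [← inner_conj_symm x (e a), ← Complex.normSq_eq_conj_mul_self, Complex.ofReal_re,
      Complex.normSq_eq_norm_sq]
  · norm_cast

theorem summable_norm_inner_sq (e : HilbertBasis α ℂ H) (x : H) :
    Summable (fun a => ‖⟪e a, x⟫_ℂ‖ ^ 2) := (hasSum_norm_inner_sq e x).summable

theorem tsum_ofReal_norm_inner_sq (e : HilbertBasis α ℂ H) (x : H) :
    ∑' a, ENNReal.ofReal (‖⟪e a, x⟫_ℂ‖ ^ 2) = ENNReal.ofReal (‖x‖ ^ 2) := by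
  rw [← (hasSum_norm_inner_sq e x).tsum_eq]
  exact (ENNReal.ofReal_tsum_of_nonneg (fun a => by positivity) (summable_norm_inner_sq e x)).symm

theorem ext_inner_basis (e : HilbertBasis α ℂ H) {x y : H} (h : ∀ a, ⟪e a, x⟫_ℂ = ⟪e a, y⟫_ℂ) :
    x = y := by
  apply e.repr.injective
  ext a
  simpa [HilbertBasis.repr_apply_apply] using h a

/-- A square-summable family is the family of coefficients of a vector. -/
theorem exists_inner_eq (e : HilbertBasis α ℂ H) {c : α → ℂ} (hc : Summable fun a => ‖c a‖ ^ 2) :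
    ∃ y : H, ∀ a, ⟪e a, y⟫_ℂ = c a := by
  refine ⟨e.repr.symm ⟨c, memℓp_gen (by simpa using hc)⟩, fun a => ?_⟩
  rw [← e.repr_apply_apply, LinearIsometryEquiv.apply_symm_apply]

theorem hasSum_inner_smul (e : HilbertBasis α ℂ H) (x : H) :
    HasSum (fun a => ⟪e a, x⟫_ℂ • e a) x := by
  simpa [HilbertBasis.repr_apply_apply] using e.hasSum_repr x

theorem continuousLinearMap_ext_basis (v : HilbertBasis α ℂ H) {A B : H →L[ℂ] H}
    (h : ∀ j, A (v j) = B (v j)) : A = B := by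
  ext x
  have h1 := ((hasSum_inner_smul v x).mapL A)
  have h2 := ((hasSum_inner_smul v x).mapL B)
  simp only [map_smul, h] at h1 h2
  exact h1.unique h2

/-- The graph of the (maximal) operator that is diagonal in the basis `e` with diagonal
entries `l`. -/
def diagonalGraph (e : HilbertBasis α ℂ H) (l : α → ℝ) : Set (H × H) :=
  {p | ∀ a, ⟪e a, p.2⟫_ℂ = l a * ⟪e a, p.1⟫_ℂ}

theorem smul_add_mem_diagonalGraph {e : HilbertBasis α ℂ H} {l : α → ℝ} {x x' y y' : H}
    (h : (x, x') ∈ diagonalGraph e l) (h' : (y, y') ∈ diagonalGraph e l) (c : ℂ) :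
    (x + c • y, x' + c • y') ∈ diagonalGraph e l := fun a => by
  have h1 := h a
  have h2 := h' a
  simp only [inner_add_right, inner_smul_right] at h1 h2 ⊢
  rw [h1, h2]
  ring

theorem basis_mem_diagonalGraph (e : HilbertBasis α ℂ H) (l : α → ℝ) (a : α) :
    (e a, (l a : ℂ) • e a) ∈ diagonalGraph e l := fun b => by
  classical
  simp only [inner_smul_right, orthonormal_iff_ite.1 e.orthonormal b a]
  split_ifs with h
  · rw [h]
  · simp

variable [CompleteSpace H]

/-- The orthogonal projection onto the closed span of the basis vectors with index in `T`. -/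
def basisProj (e : HilbertBasis α ℂ H) (T : Set α) : H →L[ℂ] H :=
  (Submodule.span ℂ (e '' T)).topologicalClosure.starProjection

theorem isStarProjection_basisProj (e : HilbertBasis α ℂ H) (T : Set α) :
    IsStarProjection (basisProj e T) := isStarProjection_starProjection

theorem basisProj_basis (e : HilbertBasis α ℂ H) (T : Set α) (a : α) :
    basisProj e T (e a) = T.indicator (fun a => e a) a := by
  by_cases ha : a ∈ T
  · rw [indicator_of_mem ha, basisProj, Submodule.starProjection_eq_self_iff]
    exact Submodule.le_topologicalClosure _ (Submodule.subset_span ⟨a, ha, rfl⟩)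
  · rw [indicator_of_notMem ha, basisProj, Submodule.starProjection_apply_eq_zero_iff,
      Submodule.orthogonal_closure, Submodule.mem_orthogonal]
    intro x hx
    induction hx using Submodule.span_induction with
    | mem x hx =>
      obtain ⟨b, hb, rfl⟩ := hx
      exact e.orthonormal.2 (fun h => ha (h ▸ hb))
    | zero => simp
    | add x y _ _ hx hy => rw [inner_add_left, hx, hy, add_zero]
    | smul c x _ hx => rw [inner_smul_left, hx, mul_zero]

theorem inner_apply_comm_of_isSelfAdjoint {A : H →L[ℂ] H} (h : IsSelfAdjoint A) (x y : H) :
    ⟪A x, y⟫_ℂ = ⟪x, A y⟫_ℂ := by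
  rw [← ContinuousLinearMap.adjoint_inner_left, ← ContinuousLinearMap.star_eq_adjoint, h.star_eq]

theorem inner_basisProj (e : HilbertBasis α ℂ H) (T : Set α) (x : H) (a : α) :
    ⟪e a, basisProj e T x⟫_ℂ = T.indicator (fun a => ⟪e a, x⟫_ℂ) a := by
  rw [← inner_apply_comm_of_isSelfAdjoint (isStarProjection_basisProj e T).isSelfAdjoint,
    basisProj_basis]
  by_cases ha : a ∈ T <;> simp [ha]

theorem hasSum_basisProj (e : HilbertBasis α ℂ H) (T : Set α) (x : H) :
    HasSum (fun a : T => ⟪e a, x⟫_ℂ • e a) (basisProj e T x) := by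
  have h := hasSum_inner_smul e (basisProj e T x)
  rw [← hasSum_subtype_iff_of_support_subset (s := T)] at h
  · convert h using 1
    funext a
    simp [inner_basisProj]
  · intro a ha
    by_contra hn
    exact ha (by simp [inner_basisProj, hn])

theorem hasSum_basisProj_iUnion (e : HilbertBasis α ℂ H) (T : ℕ → Set α)
    (hT : Pairwise (Function.onFun Disjoint T)) (x : H) :
    HasSum (fun n => basisProj e (T n) x) (basisProj e (⋃ n, T n) x) := by
  have h := hasSum_basisProj e (⋃ n, T n) x
  rw [← (Set.unionEqSigmaOfDisjoint hT).symm.hasSum_iff] at h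
  -- The expansion over the union converges unconditionally, so it can be regrouped according to the
  -- disjoint pieces.
  exact h.sigma fun n => hasSum_basisProj e (T n) x

end Basis

/-! ### Projection-valued measures -/

section PVM

variable {H : Type*} [NormedAddCommGroup H] [InnerProductSpace ℂ H] [CompleteSpace H]

namespace ProjectionValuedMeasure

variable (ξ : ProjectionValuedMeasure H)

theorem scalarMeasure_apply (x : H) {E : Set ℝ} (hE : MeasurableSet E) :
    ξ.scalarMeasure x E = ENNReal.ofReal (⟪x, ξ.proj E x⟫_ℂ).re :=
  Measure.ofMeasurable_apply E hE

theorem inner_proj_eq {E : Set ℝ} (hE : MeasurableSet E) (x : H) :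
    ⟪x, ξ.proj E x⟫_ℂ = ((‖ξ.proj E x‖ ^ 2 : ℝ) : ℂ) := by
  have h := ξ.isStarProjection E hE
  have h1 : ξ.proj E (ξ.proj E x) = ξ.proj E x :=
    congrArg (fun A : H →L[ℂ] H => A x) h.isIdempotentElem.eq
  conv_lhs => rw [← h1]
  rw [← inner_apply_comm_of_isSelfAdjoint h.isSelfAdjoint, inner_self_eq_norm_sq_to_K]
  norm_cast

theorem scalarMeasure_apply_eq_norm_sq (x : H) {E : Set ℝ} (hE : MeasurableSet E) :
    ξ.scalarMeasure x E = ENNReal.ofReal (‖ξ.proj E x‖ ^ 2) := by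
  rw [ξ.scalarMeasure_apply x hE, ξ.inner_proj_eq hE, Complex.ofReal_re]

instance (x : H) : IsFiniteMeasure (ξ.scalarMeasure x) :=
  ⟨by rw [ξ.scalarMeasure_apply x MeasurableSet.univ]; exact ENNReal.ofReal_lt_top⟩

theorem proj_union {E F : Set ℝ} (hE : MeasurableSet E) (hF : MeasurableSet F) (h : Disjoint E F)
    (x : H) : ξ.proj (E ∪ F) x = ξ.proj E x + ξ.proj F x := by
  let T : ℕ → Set ℝ := fun n => if n = 0 then E else if n = 1 then F else ∅
  have hT : ∀ n, MeasurableSet (T n) := fun n => by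
    dsimp only [T]; split_ifs <;> simp [hE, hF]
  have hd : Pairwise (Function.onFun Disjoint T) := fun m n hmn => by
    dsimp only [T, Function.onFun]
    split_ifs <;> simp_all [h.symm]
  have hU : ⋃ n, T n = E ∪ F := by
    ext t
    simp only [mem_iUnion, mem_union, T]
    constructor
    · rintro ⟨n, hn⟩
      split_ifs at hn
      exacts [Or.inl hn, Or.inr hn, hn.elim]
    · rintro (ht | ht)
      exacts [⟨0, by simpa⟩, ⟨1, by simpa⟩]
  have h1 := ξ.hasSum_iUnion T hT hd x
  rw [hU] at h1
  have h2 : HasSum (fun n => ξ.proj (T n) x) (∑ n ∈ Finset.range 2, ξ.proj (T n) x) := by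
    refine hasSum_sum_of_ne_finset_zero fun n hn => ?_
    have : T n = ∅ := by
      simp only [Finset.mem_range] at hn
      simp only [T]
      rw [if_neg (by omega), if_neg (by omega)]
    rw [this, ξ.proj_empty]
  rw [h1.unique h2]
  simp [Finset.sum_range_succ, T]

theorem proj_add_compl {E : Set ℝ} (hE : MeasurableSet E) (x : H) :
    ξ.proj E x + ξ.proj Eᶜ x = x := by
  rw [← ξ.proj_union hE hE.compl disjoint_compl_right, union_compl_self, ξ.proj_univ]
  rfl

theorem proj_proj_self {E : Set ℝ} (hE : MeasurableSet E) (x : H) :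
    ξ.proj E (ξ.proj E x) = ξ.proj E x :=
  congrArg (fun A : H →L[ℂ] H => A x) (ξ.isStarProjection E hE).isIdempotentElem.eq

/-- Additivity gives `‖ξ(E ∪ F) y‖² = ‖ξ(E) y‖² + ‖y‖²` for `y = ξ(F) x`, and `ξ(E ∪ F)` is a
contraction, so nothing is left for `ξ(E) y`. Multiplicativity of `ξ` follows from this; it is not
part of the definition. -/
theorem proj_proj_of_disjoint {E F : Set ℝ} (hE : MeasurableSet E) (hF : MeasurableSet F)
    (h : Disjoint E F) (x : H) : ξ.proj E (ξ.proj F x) = 0 := by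
  set y := ξ.proj F x with hy
  have hFy : ξ.proj F y = y := ξ.proj_proj_self hF x
  have h1 := ξ.proj_union hE hF h y
  have h2 : (‖ξ.proj (E ∪ F) y‖ ^ 2 : ℝ) = ‖ξ.proj E y‖ ^ 2 + ‖y‖ ^ 2 := by
    have h3 : ⟪y, ξ.proj (E ∪ F) y⟫_ℂ = ⟪y, ξ.proj E y⟫_ℂ + ⟪y, ξ.proj F y⟫_ℂ := by
      rw [h1, inner_add_right]
    rw [ξ.inner_proj_eq (hE.union hF), ξ.inner_proj_eq hE, ξ.inner_proj_eq hF, hFy] at h3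
    exact_mod_cast h3
  have h4 : ‖ξ.proj (E ∪ F) y‖ ≤ ‖y‖ := by
    have h5 := (ξ.inner_proj_eq (hE.union hF) y)
    have h6 := norm_inner_le_norm (𝕜 := ℂ) y (ξ.proj (E ∪ F) y)
    rw [h5, Complex.norm_real, Real.norm_eq_abs, abs_of_nonneg (by positivity)] at h6
    by_contra hlt
    push Not at hlt
    nlinarith [norm_nonneg y]
  have h7 : ‖ξ.proj E y‖ ^ 2 = 0 := by
    nlinarith [norm_nonneg (ξ.proj (E ∪ F) y), norm_nonneg y, sq_nonneg ‖ξ.proj E y‖]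
  simpa using h7

theorem proj_proj {E F : Set ℝ} (hE : MeasurableSet E) (hF : MeasurableSet F) (x : H) :
    ξ.proj E (ξ.proj F x) = ξ.proj (E ∩ F) x := by
  have h1 : ξ.proj F x = ξ.proj (E ∩ F) x + ξ.proj (F \ E) x := by
    rw [← ξ.proj_union (hE.inter hF) (hF.diff hE)
      (disjoint_sdiff_right.mono_left inter_subset_left), inter_comm, inter_union_sdiff]
  have h2 : ∀ y, ξ.proj E y = ξ.proj (E ∩ F) y + ξ.proj (E \ F) y := fun y => by
    rw [← ξ.proj_union (hE.inter hF) (hE.diff hF)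
      (disjoint_sdiff_right.mono_left inter_subset_right), inter_union_sdiff]
  rw [h1, map_add, ξ.proj_proj_of_disjoint hE (hF.diff hE) disjoint_sdiff_right, add_zero, h2,
    ξ.proj_proj_self (hE.inter hF), ξ.proj_proj_of_disjoint (hE.diff hF) (hE.inter hF)
      (disjoint_sdiff_left.mono_right inter_subset_right), add_zero]

/-- The scalar measure of a vector `ξ(E) x + c ξ(Eᶜ) x`. -/
theorem scalarMeasure_proj_add_smul {E : Set ℝ} (hE : MeasurableSet E) (x : H) (c : ℂ) :
    ξ.scalarMeasure (ξ.proj E x + c • ξ.proj Eᶜ x) = (ξ.scalarMeasure x).restrict E +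
      ENNReal.ofReal (‖c‖ ^ 2) • (ξ.scalarMeasure x).restrict Eᶜ := by
  ext F hF
  rw [ξ.scalarMeasure_apply_eq_norm_sq _ hF, map_add, map_smul, ξ.proj_proj hF hE,
    ξ.proj_proj hF hE.compl, Measure.add_apply, Measure.smul_apply, Measure.restrict_apply hF,
    Measure.restrict_apply hF, ξ.scalarMeasure_apply_eq_norm_sq _ (hF.inter hE),
    ξ.scalarMeasure_apply_eq_norm_sq _ (hF.inter hE.compl), smul_eq_mul,
    ← ENNReal.ofReal_mul (by positivity), ← ENNReal.ofReal_add (by positivity) (by positivity)]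
  congr 1
  have h0 : ⟪ξ.proj (F ∩ E) x, ξ.proj (F ∩ Eᶜ) x⟫_ℂ = 0 := by
    rw [inner_apply_comm_of_isSelfAdjoint (ξ.isStarProjection _ (hF.inter hE)).isSelfAdjoint,
      ξ.proj_proj_of_disjoint (hF.inter hE) (hF.inter hE.compl)
        (disjoint_compl_right.mono inter_subset_right inter_subset_right), inner_zero_right]
  have h1 := norm_add_sq (𝕜 := ℂ) (ξ.proj (F ∩ E) x) (c • ξ.proj (F ∩ Eᶜ) x)
  rw [inner_smul_right, h0, norm_smul] at h1
  simpa [mul_pow] using h1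

theorem scalarMeasure_proj {E : Set ℝ} (hE : MeasurableSet E) (x : H) :
    ξ.scalarMeasure (ξ.proj E x) = (ξ.scalarMeasure x).restrict E := by
  simpa using ξ.scalarMeasure_proj_add_smul hE x 0

/-- A projection-valued measure for which the basis `e` consists of eigenvectors has scalar
measures that are sums of point masses. -/
theorem scalarMeasure_eq_sum_dirac {α : Type*} (e : HilbertBasis α ℂ H) (l : α → ℝ)
    (h : ∀ E, MeasurableSet E → ∀ x a, ⟪e a, ξ.proj E x⟫_ℂ =
      (l ⁻¹' E).indicator (fun a => ⟪e a, x⟫_ℂ) a) (x : H) :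
    ξ.scalarMeasure x =
      Measure.sum fun a => ENNReal.ofReal (‖⟪e a, x⟫_ℂ‖ ^ 2) • Measure.dirac (l a) := by
  ext E hE
  rw [ξ.scalarMeasure_apply_eq_norm_sq _ hE, ← tsum_ofReal_norm_inner_sq e, Measure.sum_apply _ hE]
  refine tsum_congr fun a => ?_
  rw [h E hE]
  by_cases ha : l a ∈ E <;> simp [ha]

end ProjectionValuedMeasure

/-! ### Diagonal operators -/

variable {α : Type*}

/-- The projection-valued measure of a diagonal operator. -/
def diagonalPVM (e : HilbertBasis α ℂ H) (l : α → ℝ) : ProjectionValuedMeasure H where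
  proj E := basisProj e (l ⁻¹' E)
  isStarProjection _ _ := isStarProjection_basisProj e _
  proj_univ := by
    ext x
    exact ext_inner_basis e fun a => by simp [inner_basisProj]
  hasSum_iUnion E _ hd x := by
    rw [preimage_iUnion]
    exact hasSum_basisProj_iUnion e _ (fun m n hmn => (hd hmn).preimage l) x

theorem scalarMeasure_diagonalPVM (e : HilbertBasis α ℂ H) (l : α → ℝ) (x : H) :
    (diagonalPVM e l).scalarMeasure x =
      Measure.sum fun a => ENNReal.ofReal (‖⟪e a, x⟫_ℂ‖ ^ 2) • Measure.dirac (l a) :=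
  (diagonalPVM e l).scalarMeasure_eq_sum_dirac e l (fun _ _ x a => inner_basisProj e _ x a) x

theorem integrable_id_of_lintegral_sq {μ : Measure ℝ} [IsFiniteMeasure μ]
    (h : ∫⁻ t, ENNReal.ofReal (t ^ 2) ∂μ < ∞) : Integrable (fun t : ℝ => t) μ := by
  have h2 : Integrable (fun t : ℝ => t ^ 2) μ :=
    ⟨by fun_prop, by
      rw [hasFiniteIntegral_iff_ofReal (ae_of_all _ fun t => sq_nonneg t)]
      exact h⟩
  refine (h2.add (integrable_const 1)).mono' (by fun_prop) (ae_of_all _ fun t => ?_)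
  simp only [Real.norm_eq_abs, Pi.add_apply]
  nlinarith [sq_nonneg (|t| - 1), sq_abs t]

/-- The second moment of the scalar measure is `∑ |lₐ ⟨eₐ, x⟩|²`; its finiteness is exactly the
condition for these coefficients to define a vector. The quadratic form is then Parseval's identity.
-/
theorem isSpectralMeasure_diagonalPVM (e : HilbertBasis α ℂ H) (l : α → ℝ) :
    IsSpectralMeasure (diagonalPVM e l) (diagonalGraph e l) := by
  have hdom : ∀ x : H, (∃ y, (x, y) ∈ diagonalGraph e l) ↔
      ∫⁻ t, ENNReal.ofReal (t ^ 2) ∂((diagonalPVM e l).scalarMeasure x) < ∞ := by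
    intro x
    have hint : ∫⁻ t, ENNReal.ofReal (t ^ 2) ∂((diagonalPVM e l).scalarMeasure x) =
        ∑' a, ENNReal.ofReal (‖(l a : ℂ) * ⟪e a, x⟫_ℂ‖ ^ 2) := by
      rw [scalarMeasure_diagonalPVM, lintegral_sum_measure]
      refine tsum_congr fun a => ?_
      rw [lintegral_smul_measure, lintegral_dirac, smul_eq_mul, ← ENNReal.ofReal_mul (by positivity),
        norm_mul, mul_pow, Complex.norm_real, Real.norm_eq_abs, sq_abs, mul_comm]
    rw [hint]
    constructor
    · rintro ⟨y, hy⟩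
      have hy' : ∀ a, (l a : ℂ) * ⟪e a, x⟫_ℂ = ⟪e a, y⟫_ℂ := fun a => (hy a).symm
      simp only [hy', tsum_ofReal_norm_inner_sq]
      exact ENNReal.ofReal_lt_top
    · intro h
      have hs : Summable fun a => ‖(l a : ℂ) * ⟪e a, x⟫_ℂ‖ ^ 2 := by
        refine (ENNReal.summable_toReal h.ne).congr fun a => ?_
        rw [ENNReal.toReal_ofReal (by positivity)]
      exact exists_inner_eq e hs
  refine ⟨hdom, fun x y hxy => ?_⟩
  have hi := integrable_id_of_lintegral_sq ((hdom x).1 ⟨y, hxy⟩)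
  rw [scalarMeasure_diagonalPVM] at hi ⊢
  have h1 := (hasSum_integral_measure hi)
  have h2 := e.hasSum_inner_mul_inner x y
  refine h2.unique ?_
  rw [← Complex.hasSum_ofReal] at h1
  refine h1.congr_fun fun a => ?_
  rw [hxy a, integral_smul_measure, integral_dirac, ENNReal.toReal_ofReal (by positivity),
    ← inner_conj_symm x (e a), mul_left_comm, ← Complex.normSq_eq_conj_mul_self,
    Complex.normSq_eq_norm_sq, smul_eq_mul, mul_comm]
  push_cast
  rfl

/-- The spectral measure of an eigenvector of a diagonal operator is a point mass. -/
theorem ae_eq_scalarMeasure_basis {e : HilbertBasis α ℂ H} {l : α → ℝ}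
    {ξ : ProjectionValuedMeasure H} (hξ : IsSpectralMeasure ξ (diagonalGraph e l)) (a : α) :
    ∀ᵐ t ∂(ξ.scalarMeasure (e a)), t = l a := by
  set μ := ξ.scalarMeasure (e a) with hμ
  have hfin : ∫⁻ t, ENNReal.ofReal (t ^ 2) ∂μ < ∞ :=
    (hξ.mem_domain_iff (e a)).1 ⟨_, basis_mem_diagonalGraph e l a⟩
  have hint := integrable_id_of_lintegral_sq hfin
  -- It suffices that `∫_E t dμ = lₐ μ(E)` for every Borel set `E`. The eigenvector is split as `y +
  -- z` along `E` and its complement.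
  refine Integrable.ae_eq_of_forall_setIntegral_eq _ _ hint (integrable_const _) fun E hE _ => ?_
  set y := ξ.proj E (e a) with hy
  set z := ξ.proj Eᶜ (e a) with hz
  have hyz : y + z = e a := ξ.proj_add_compl hE (e a)
  have hμy : ξ.scalarMeasure y = μ.restrict E := ξ.scalarMeasure_proj hE _
  have hμz : ξ.scalarMeasure z = μ.restrict Eᶜ := ξ.scalarMeasure_proj hE.compl _
  obtain ⟨y', hy'⟩ : ∃ y', (y, y') ∈ diagonalGraph e l := by
    rw [hξ.mem_domain_iff, hμy]
    exact (lintegral_mono' Measure.restrict_le_self le_rfl).trans_lt hfin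
  have hz' : (z, (l a : ℂ) • e a - y') ∈ diagonalGraph e l := by
    have h := smul_add_mem_diagonalGraph (basis_mem_diagonalGraph e l a) hy' (-1)
    simpa [← hyz, ← sub_eq_add_neg] using h
  set z' := (l a : ℂ) • e a - y' with hz'def
  -- For `|c| = 1` the scalar measure of `y + c z` does not depend on `c`, so neither does the
  -- quadratic form there, and its cross terms must cancel. The values `c = 1` and `c = i` then give
  -- `⟨y, z'⟩ = 0`.
  have key : ∀ c : ℂ, ‖c‖ = 1 → c * ⟪y, z'⟫_ℂ + starRingEnd ℂ c * ⟪z, y'⟫_ℂ = 0 := by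
    intro c hc
    have h1 := hξ.inner_eq_integral _ _ (smul_add_mem_diagonalGraph hy' hz' c)
    have h2 := hξ.inner_eq_integral _ _ hy'
    have h3 := hξ.inner_eq_integral _ _ hz'
    rw [ξ.scalarMeasure_proj_add_smul hE, ← hμ, hc, one_pow, ENNReal.ofReal_one, one_smul,
      integral_add_measure hint.integrableOn hint.integrableOn, ← hμy, ← hμz, Complex.ofReal_add,
      ← h2, ← h3] at h1
    simp only [inner_add_left, inner_add_right, inner_smul_left, inner_smul_right] at h1
    have hcc : starRingEnd ℂ c * c = 1 := by
      rw [← Complex.normSq_eq_conj_mul_self, Complex.normSq_eq_norm_sq, hc]; simp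
    linear_combination h1 - ⟪z, z'⟫_ℂ * hcc
  have k1 := key 1 (by simp)
  have k2 := key Complex.I (by simp)
  have hyz0 : ⟪y, z'⟫_ℂ = 0 := by
    simp only [map_one, one_mul, Complex.conj_I] at k1 k2
    linear_combination (1 / 2 : ℂ) * k1 - (Complex.I / 2) * k2 +
      (1 / 2 : ℂ) * (⟪y, z'⟫_ℂ - ⟪z, y'⟫_ℂ) * Complex.I_sq
  -- With the cross term gone, `lₐ ⟨y, eₐ⟩ = ⟨y, y'⟩`; the sides are `lₐ μ(E)` and `∫_E t dμ`.
  have h4 : ⟪y, (l a : ℂ) • e a⟫_ℂ = ⟪y, y'⟫_ℂ := by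
    have : (l a : ℂ) • e a = y' + z' := by rw [hz'def]; abel
    rw [this, inner_add_right, hyz0, add_zero]
  rw [hξ.inner_eq_integral _ _ hy', hμy, inner_smul_right, hy,
    inner_apply_comm_of_isSelfAdjoint (ξ.isStarProjection E hE).isSelfAdjoint,
    ξ.inner_proj_eq hE] at h4
  rw [setIntegral_const, smul_eq_mul, Measure.real, hμ, ξ.scalarMeasure_apply_eq_norm_sq _ hE,
    ENNReal.toReal_ofReal (by positivity), mul_comm]
  exact_mod_cast h4.symm

/-- Every spectral measure of a diagonal operator has the scalar measures
`∑ |⟨eₐ, x⟩|² δ_{lₐ}`. -/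
theorem IsSpectralMeasure.scalarMeasure_eq {e : HilbertBasis α ℂ H} {l : α → ℝ}
    {ξ : ProjectionValuedMeasure H} (hξ : IsSpectralMeasure ξ (diagonalGraph e l)) (x : H) :
    ξ.scalarMeasure x =
      Measure.sum fun a => ENNReal.ofReal (‖⟪e a, x⟫_ℂ‖ ^ 2) • Measure.dirac (l a) := by
  have hzero : ∀ E, MeasurableSet E → ∀ a, l a ∉ E → ξ.proj E (e a) = 0 := by
    intro E hE a ha
    have h1 : ξ.scalarMeasure (e a) E = 0 :=
      measure_mono_null (t := {t | ¬ t = l a}) (fun t ht h => ha (h ▸ ht))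
        (ae_iff.1 (ae_eq_scalarMeasure_basis hξ a))
    rw [ξ.scalarMeasure_apply_eq_norm_sq _ hE, ENNReal.ofReal_eq_zero] at h1
    simpa using le_antisymm h1 (by positivity)
  refine ξ.scalarMeasure_eq_sum_dirac e l (fun E hE x a => ?_) x
  rw [← inner_apply_comm_of_isSelfAdjoint (ξ.isStarProjection E hE).isSelfAdjoint]
  by_cases ha : l a ∈ E
  · have h1 := ξ.proj_add_compl hE (e a)
    rw [hzero Eᶜ hE.compl a (by simpa using ha), add_zero] at h1
    rw [h1, indicator_of_mem (by exact ha)]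
  · rw [hzero E hE a ha, indicator_of_notMem (by exact ha), inner_zero_left]

theorem scalarMeasure_spectralMeasure_diagonalGraph (e : HilbertBasis α ℂ H) (l : α → ℝ) (x : H) :
    (spectralMeasure (diagonalGraph e l)).scalarMeasure x =
      Measure.sum fun a => ENNReal.ofReal (‖⟪e a, x⟫_ℂ‖ ^ 2) • Measure.dirac (l a) :=
  IsSpectralMeasure.scalarMeasure_eq
    (Classical.epsilon_spec (p := fun ξ => IsSpectralMeasure ξ (diagonalGraph e l))
      ⟨_, isSpectralMeasure_diagonalPVM e l⟩) x

end PVM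

/-! ### Hilbert–Schmidt operators -/

section HilbertSchmidtBasis

variable {K : Type*} [NormedAddCommGroup K] [InnerProductSpace ℂ K] [CompleteSpace K]
  {ι κ : Type*}

/-- Both sides are the double sum of `|⟨vⱼ, A bᵢ⟩|²`. In `ℝ≥0∞` the order of summation is
immaterial, so no summability is assumed. -/
theorem tsum_ofReal_norm_sq_adjoint (b : HilbertBasis ι ℂ K) (v : HilbertBasis κ ℂ K)
    (A : K →L[ℂ] K) :
    ∑' i, ENNReal.ofReal (‖A (b i)‖ ^ 2) =
      ∑' j, ENNReal.ofReal (‖ContinuousLinearMap.adjoint A (v j)‖ ^ 2) := by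
  simp_rw [← tsum_ofReal_norm_inner_sq v (A (b _)),
    ← tsum_ofReal_norm_inner_sq b (ContinuousLinearMap.adjoint A (v _))]
  rw [ENNReal.tsum_comm]
  refine tsum_congr fun j => tsum_congr fun i => ?_
  rw [ContinuousLinearMap.adjoint_inner_right, norm_inner_symm]

theorem mem_hilbertSchmidtSubmodule_iff (A : K →L[ℂ] K) :
    A ∈ hilbertSchmidtSubmodule K ↔ ∑' i, ENNReal.ofReal (‖A (stdBasis K i)‖ ^ 2) ≠ ∞ := by
  change (Summable fun i => ‖A (stdBasis K i)‖ ^ 2) ↔ _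
  refine ⟨fun h => h.tsum_ofReal_ne_top, fun h => ?_⟩
  refine (ENNReal.summable_toReal h).congr fun i => ?_
  rw [ENNReal.toReal_ofReal (by positivity)]

theorem adjoint_mem_hilbertSchmidtSubmodule {A : K →L[ℂ] K} (hA : A ∈ hilbertSchmidtSubmodule K) :
    ContinuousLinearMap.adjoint A ∈ hilbertSchmidtSubmodule K := by
  rw [mem_hilbertSchmidtSubmodule_iff] at hA ⊢
  rwa [← tsum_ofReal_norm_sq_adjoint (stdBasis K)]

theorem mul_mem_hilbertSchmidtSubmodule_left {A : K →L[ℂ] K} (B : K →L[ℂ] K)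
    (hA : A ∈ hilbertSchmidtSubmodule K) : B * A ∈ hilbertSchmidtSubmodule K := by
  have hA' : Summable fun i => ‖A (stdBasis K i)‖ ^ 2 := hA
  change Summable fun i => ‖(B * A) (stdBasis K i)‖ ^ 2
  refine Summable.of_nonneg_of_le (fun i => by positivity) (fun i => ?_) (hA'.mul_left (‖B‖ ^ 2))
  rw [← mul_pow]
  exact pow_le_pow_left₀ (norm_nonneg _) (B.le_opNorm _) 2

theorem mul_mem_hilbertSchmidtSubmodule_right {A : K →L[ℂ] K} (B : K →L[ℂ] K)
    (hA : A ∈ hilbertSchmidtSubmodule K) : A * B ∈ hilbertSchmidtSubmodule K := by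
  have h := adjoint_mem_hilbertSchmidtSubmodule (mul_mem_hilbertSchmidtSubmodule_left
    (ContinuousLinearMap.adjoint B) (adjoint_mem_hilbertSchmidtSubmodule hA))
  simp only [← ContinuousLinearMap.star_eq_adjoint, star_mul, star_star] at h
  exact h

/-- The rank one operator `|x⟩⟨y|` as a Hilbert–Schmidt operator. -/
def rankOneHS (x y : K) : HilbertSchmidt K where
  op := InnerProductSpace.rankOne ℂ x y
  mem := by
    refine ((summable_norm_inner_sq (stdBasis K) y).mul_left (‖x‖ ^ 2)).congr fun i => ?_
    rw [InnerProductSpace.rankOne_apply, norm_smul, mul_pow, norm_inner_symm, mul_comm]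

theorem rankOneHS_op_apply (x y z : K) : (rankOneHS x y).op z = ⟪y, z⟫_ℂ • x :=
  InnerProductSpace.rankOne_apply ..

/-- Parseval for the vectors `A†x` and `y`. Coefficients in the rank one basis are thus matrix
elements. -/
theorem inner_rankOneHS (x y : K) (A : HilbertSchmidt K) :
    ⟪rankOneHS x y, A⟫_ℂ = ⟪x, A.op y⟫_ℂ := by
  rw [HilbertSchmidt.inner_def, ← ContinuousLinearMap.adjoint_inner_left,
    ← (stdBasis K).tsum_inner_mul_inner]
  refine tsum_congr fun i => ?_
  rw [rankOneHS_op_apply, inner_smul_left, inner_conj_symm, ContinuousLinearMap.adjoint_inner_left,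
    mul_comm]

theorem orthonormal_rankOneHS (u : HilbertBasis ι ℂ K) (v : HilbertBasis κ ℂ K) :
    Orthonormal ℂ fun a : ι × κ => rankOneHS (u a.1) (v a.2) := by
  classical
  rw [orthonormal_iff_ite]
  rintro ⟨i, j⟩ ⟨i', j'⟩
  rw [inner_rankOneHS, rankOneHS_op_apply, inner_smul_right,
    orthonormal_iff_ite.1 u.orthonormal, orthonormal_iff_ite.1 v.orthonormal]
  by_cases h1 : i = i' <;> by_cases h2 : j = j' <;> simp [h1, h2, eq_comm]

/-- The Hilbert basis `|uᵢ⟩⟨vⱼ|` of the Hilbert–Schmidt operators. -/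
def rankOneBasis (u : HilbertBasis ι ℂ K) (v : HilbertBasis κ ℂ K) :
    HilbertBasis (ι × κ) ℂ (HilbertSchmidt K) :=
  HilbertBasis.mkOfOrthogonalEqBot (orthonormal_rankOneHS u v) (by
    rw [Submodule.eq_bot_iff]
    intro A hA
    refine HilbertSchmidt.op_injective (continuousLinearMap_ext_basis v fun j => ?_)
    refine ext_inner_basis u fun i => ?_
    rw [← inner_rankOneHS,
      (Submodule.mem_orthogonal _ A).1 hA _ (Submodule.subset_span ⟨(i, j), rfl⟩)]
    exact inner_zero_right _ |>.symm)

theorem rankOneBasis_apply (u : HilbertBasis ι ℂ K) (v : HilbertBasis κ ℂ K) (a : ι × κ) :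
    rankOneBasis u v a = rankOneHS (u a.1) (v a.2) :=
  congrFun (HilbertBasis.coe_mkOfOrthogonalEqBot _ _) a

theorem inner_rankOneBasis (u : HilbertBasis ι ℂ K) (v : HilbertBasis κ ℂ K) (a : ι × κ)
    (A : HilbertSchmidt K) : ⟪rankOneBasis u v a, A⟫_ℂ = ⟪u a.1, A.op (v a.2)⟫_ℂ := by
  rw [rankOneBasis_apply, inner_rankOneHS]

end HilbertSchmidtBasis

/-! ### States and their eigenvectors -/

section States

variable {K : Type*} [NormedAddCommGroup K] [InnerProductSpace ℂ K] [CompleteSpace K]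
  {ι : Type*} {ρ : DensityOperator K} {r : ι → ℝ} {u : HilbertBasis ι ℂ K}

theorem DensityOperator.sqrt_isPositive (ρ : DensityOperator K) : ρ.sqrt.IsPositive :=
  (ContinuousLinearMap.nonneg_iff_isPositive _).1 (CFC.sqrt_nonneg ρ.op)

theorem DensityOperator.isSelfAdjoint_sqrt (ρ : DensityOperator K) : IsSelfAdjoint ρ.sqrt :=
  IsSelfAdjoint.of_nonneg (CFC.sqrt_nonneg ρ.op)

theorem DensityOperator.sqrt_sqrt_apply (ρ : DensityOperator K) (x : K) :
    ρ.sqrt (ρ.sqrt x) = ρ.op x :=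
  congrArg (fun A : K →L[ℂ] K => A x) (CFC.sqrt_mul_sqrt_self ρ.op
    ((ContinuousLinearMap.nonneg_iff_isPositive _).2 ρ.isPositive))

namespace IsSpectralDecomposition

theorem op_apply (h : IsSpectralDecomposition ρ r u) (i : ι) : ρ.op (u i) = (r i : ℂ) • u i := by
  classical
  refine (h.hasSum_apply (u i)).unique ?_
  convert hasSum_single (f := fun j => (r j : ℂ) • ⟪u j, u i⟫_ℂ • u j) i fun j hj => ?_ using 1
  · simp [u.orthonormal.1 i]
  · simp [u.orthonormal.2 hj]

/-- The defect `w = √ρ uᵢ - √rᵢ uᵢ` satisfies `(√ρ + √rᵢ) w = (ρ - rᵢ) uᵢ = 0`, so positivity of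
`√ρ` forces `√rᵢ ‖w‖² ≤ 0`. If `rᵢ = 0`, then `w = √ρ uᵢ` and `‖w‖² = ⟨uᵢ, √ρ w⟩ = 0`. -/
theorem sqrt_apply (h : IsSpectralDecomposition ρ r u) (i : ι) :
    ρ.sqrt (u i) = (√(r i) : ℂ) • u i := by
  set w := ρ.sqrt (u i) - (√(r i) : ℂ) • u i with hw
  have hsq : ((√(r i) : ℝ) : ℂ) * (√(r i) : ℝ) = r i := by
    rw [← Complex.ofReal_mul, Real.mul_self_sqrt (h.nonneg i)]
  have h1 : ρ.sqrt w = -(√(r i) : ℂ) • w := by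
    rw [hw, map_sub, ρ.sqrt_sqrt_apply, h.op_apply, map_smul, smul_sub, smul_smul, ← hsq]
    simp only [neg_smul, neg_mul]
    abel
  have h2 : 0 ≤ (⟪w, ρ.sqrt w⟫_ℂ).re := ρ.sqrt_isPositive.re_inner_nonneg_right w
  have h3 : 0 ≤ -(√(r i) * ‖w‖ ^ 2) := by
    refine h2.trans_eq ?_
    rw [h1, inner_smul_right, inner_self_eq_norm_sq_to_K, ← Complex.ofReal_neg,
      Complex.re_ofReal_mul, neg_mul]
    norm_cast
  have h4 : w = 0 := by
    rcases (Real.sqrt_nonneg (r i)).eq_or_lt with h0 | h0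
    · have h5 : ρ.sqrt w = 0 := by rw [h1, ← h0]; simp
      have h6 : w = ρ.sqrt (u i) := by rw [hw, ← h0]; simp
      rw [← inner_self_eq_zero (𝕜 := ℂ)]
      nth_rw 1 [h6]
      rw [inner_apply_comm_of_isSelfAdjoint ρ.isSelfAdjoint_sqrt, h5, inner_zero_right]
    · have : ‖w‖ ^ 2 = 0 := by nlinarith [sq_nonneg ‖w‖]
      simpa using this
  exact sub_eq_zero.1 h4

theorem kerProj_apply (h : IsSpectralDecomposition ρ r u) (i : ι) :
    ρ.kerProj (u i) = if r i = 0 then u i else 0 := by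
  split_ifs with hr
  · rw [DensityOperator.kerProj, Submodule.starProjection_eq_self_iff]
    change ρ.op (u i) = 0
    rw [h.op_apply, hr]
    simp
  · rw [DensityOperator.kerProj, Submodule.starProjection_apply_eq_zero_iff,
      Submodule.mem_orthogonal']
    intro x hx
    have hx' : ρ.op x = 0 := hx
    have h1 := inner_apply_comm_of_isSelfAdjoint ρ.isPositive.isSelfAdjoint (u i) x
    rw [h.op_apply, hx', inner_zero_right, inner_smul_left] at h1
    simpa [hr] using h1

theorem suppProj_apply (h : IsSpectralDecomposition ρ r u) (i : ι) :
    ρ.suppProj (u i) = if r i = 0 then 0 else u i := by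
  have h1 : ρ.suppProj (u i) = u i - ρ.kerProj (u i) := by
    rw [DensityOperator.suppProj, Submodule.starProjection_orthogonal']
    rfl
  rw [h1, h.kerProj_apply]
  split_ifs <;> simp

end IsSpectralDecomposition

theorem DensityOperator.isSelfAdjoint_suppProj (ρ : DensityOperator K) :
    IsSelfAdjoint ρ.suppProj := isStarProjection_starProjection.isSelfAdjoint

end States

/-! ### The relative modular operator is diagonal -/

section ModularOperator

variable {K : Type*} [NormedAddCommGroup K] [InnerProductSpace ℂ K] [CompleteSpace K]
  {ι : Type*} {ρ σ : DensityOperator K} {r s : ι → ℝ} {u v : HilbertBasis ι ℂ K}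

/-- The matrix elements of `S` do not involve the chosen `X` and `Y`. For `sⱼ = 0` the left side
vanishes through `Π_σ vⱼ = 0` and the right side through `rᵢ / 0 = 0`. -/
theorem inner_snd_of_mem_graphS (hρ : IsSpectralDecomposition ρ r u)
    (hσ : IsSpectralDecomposition σ s v) {p : HilbertSchmidt K × HilbertSchmidt K}
    (hp : p ∈ graphS ρ σ) (i j : ι) :
    ⟪rankOneHS (v j) (u i), p.2⟫_ℂ =
      √(r i / s j) * starRingEnd ℂ ⟪rankOneHS (u i) (v j), p.1⟫_ℂ := by
  obtain ⟨X, Y, h1, h2⟩ := hp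
  rw [inner_rankOneHS, inner_rankOneHS, h1, h2, Real.sqrt_div' _ (hσ.nonneg j)]
  simp only [mul_apply_eq_comp, add_apply, sub_apply, one_apply_eq_self, hρ.sqrt_apply,
    hσ.sqrt_apply, hσ.suppProj_apply, map_smul, inner_smul_right, inner_add_right]
  rw [← inner_apply_comm_of_isSelfAdjoint σ.isSelfAdjoint_suppProj, hσ.suppProj_apply]
  split_ifs with hs
  · simp [hs]
  · have hs' : ((√(s j) : ℝ) : ℂ) ≠ 0 := by
      rw [Complex.ofReal_ne_zero]
      exact (Real.sqrt_pos.2 ((hσ.nonneg j).lt_of_ne' hs)).ne'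
    rw [ContinuousLinearMap.adjoint_inner_right, ← inner_conj_symm (X (v j))]
    simp only [sub_self, map_zero, inner_zero_right, add_zero, map_mul, Complex.conj_ofReal]
    push_cast
    field_simp

theorem inner_snd_of_mem_closure_graphS (hρ : IsSpectralDecomposition ρ r u)
    (hσ : IsSpectralDecomposition σ s v) {p : HilbertSchmidt K × HilbertSchmidt K}
    (hp : p ∈ closure (graphS ρ σ)) (i j : ι) :
    ⟪rankOneHS (v j) (u i), p.2⟫_ℂ =
      √(r i / s j) * starRingEnd ℂ ⟪rankOneHS (u i) (v j), p.1⟫_ℂ := by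
  have hc : IsClosed {p : HilbertSchmidt K × HilbertSchmidt K | ⟪rankOneHS (v j) (u i), p.2⟫_ℂ =
      √(r i / s j) * starRingEnd ℂ ⟪rankOneHS (u i) (v j), p.1⟫_ℂ} := by
    refine isClosed_eq (by fun_prop) ?_
    exact continuous_const.mul (Complex.continuous_conj.comp (by fun_prop))
  exact closure_minimal (fun q hq => inner_snd_of_mem_graphS hρ hσ hq i j) hc hp

theorem zero_mem_graphS (ρ σ : DensityOperator K) : 0 ∈ graphS ρ σ := by
  refine ⟨0, 0, ?_, ?_⟩
  · change (0 : K →L[ℂ] K) = 0 * _ + 0 * _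
    simp
  · change (0 : K →L[ℂ] K) = _
    simp

theorem add_mem_graphS {p q : HilbertSchmidt K × HilbertSchmidt K} (hp : p ∈ graphS ρ σ)
    (hq : q ∈ graphS ρ σ) : p + q ∈ graphS ρ σ := by
  obtain ⟨X, Y, h1, h2⟩ := hp
  obtain ⟨X', Y', h1', h2'⟩ := hq
  refine ⟨X + X', Y + Y', ?_, ?_⟩
  · change p.1.op + q.1.op = _ + (Y.op + Y'.op) * _
    rw [h1, h1', add_mul, add_mul]
    abel
  · change p.2.op + q.2.op = _
    rw [h2, h2', map_add, mul_add, add_mul]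

/-- For `sⱼ ≠ 0` take `X = (c/√sⱼ) |uᵢ⟩⟨vⱼ|` and `Y = 0`; for `sⱼ = 0` the operator lives on `ker
σ`, so `X = 0` and `Y = c |uᵢ⟩⟨vⱼ|`. -/
theorem smul_rankOneHS_mem_graphS (hρ : IsSpectralDecomposition ρ r u)
    (hσ : IsSpectralDecomposition σ s v) (i j : ι) (c : ℂ) :
    (c • rankOneHS (u i) (v j),
      (√(r i / s j) * starRingEnd ℂ c) • rankOneHS (v j) (u i)) ∈ graphS ρ σ := by
  rw [Real.sqrt_div' _ (hσ.nonneg j)]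
  by_cases hs : s j = 0
  · refine ⟨0, c • rankOneHS (u i) (v j), ?_, ?_⟩
    · ext z
      change c • (rankOneHS (u i) (v j)).op z =
        0 + c • (rankOneHS (u i) (v j)).op ((1 - σ.suppProj) z)
      rw [rankOneHS_op_apply, rankOneHS_op_apply, sub_apply, inner_sub_right,
        ← inner_apply_comm_of_isSelfAdjoint σ.isSelfAdjoint_suppProj, hσ.suppProj_apply]
      simp [hs]
    · ext z
      change ((_ : ℂ) • (rankOneHS (v j) (u i)).op) z = _
      simp [hs]
  · have hs' : ((√(s j) : ℝ) : ℂ) ≠ 0 := by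
      rw [Complex.ofReal_ne_zero]
      exact (Real.sqrt_pos.2 ((hσ.nonneg j).lt_of_ne' hs)).ne'
    refine ⟨(c / (√(s j) : ℂ)) • InnerProductSpace.rankOne ℂ (u i) (v j), 0, ?_, ?_⟩
    · ext z
      change c • (rankOneHS (u i) (v j)).op z = (c / (√(s j) : ℂ)) •
        InnerProductSpace.rankOne ℂ (u i) (v j) (σ.sqrt z) + 0
      rw [rankOneHS_op_apply, InnerProductSpace.rankOne_apply,
        ← inner_apply_comm_of_isSelfAdjoint σ.isSelfAdjoint_sqrt, hσ.sqrt_apply, inner_smul_left,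
        Complex.conj_ofReal, smul_smul, smul_smul, add_zero]
      congr 1
      field_simp
    · ext z
      change (_ : ℂ) • (rankOneHS (v j) (u i)).op z = σ.suppProj (ContinuousLinearMap.adjoint
        ((c / (√(s j) : ℂ)) • InnerProductSpace.rankOne ℂ (u i) (v j)) (ρ.sqrt z))
      rw [map_smulₛₗ, InnerProductSpace.adjoint_rankOne, smul_apply, map_smul,
        InnerProductSpace.rankOne_apply, map_smul, hσ.suppProj_apply, if_neg hs,
        ← inner_apply_comm_of_isSelfAdjoint ρ.isSelfAdjoint_sqrt, hρ.sqrt_apply, inner_smul_left,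
        rankOneHS_op_apply, smul_smul, smul_smul]
      congr 1
      simp only [map_div₀, Complex.conj_ofReal]
      push_cast
      field_simp

/-- Converse of `inner_snd_of_mem_closure_graphS`: the two basis expansions, indexed alike after
swapping coordinates, have partial sums that lie in the graph term by term. -/
theorem mem_closure_graphS (hρ : IsSpectralDecomposition ρ r u)
    (hσ : IsSpectralDecomposition σ s v) {p : HilbertSchmidt K × HilbertSchmidt K}
    (hp : ∀ i j, ⟪rankOneHS (v j) (u i), p.2⟫_ℂ =
      √(r i / s j) * starRingEnd ℂ ⟪rankOneHS (u i) (v j), p.1⟫_ℂ) :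
    p ∈ closure (graphS ρ σ) := by
  have h1 := hasSum_inner_smul (rankOneBasis u v) p.1
  have h2 := hasSum_inner_smul (rankOneBasis v u) p.2
  rw [← (Equiv.prodComm ι ι).hasSum_iff] at h2
  have h3 := h1.prodMk h2
  refine mem_closure_of_tendsto h3 (Eventually.of_forall fun t => ?_)
  classical
  induction t using Finset.induction_on with
  | empty => simpa using zero_mem_graphS ρ σ
  | insert a t ha ih =>
    rw [Finset.sum_insert ha]
    refine add_mem_graphS ?_ ih
    simp only [Function.comp_apply, Equiv.prodComm_apply, rankOneBasis_apply, Prod.fst_swap,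
      Prod.snd_swap, hp]
    exact smul_rankOneHS_mem_graphS hρ hσ a.1 a.2 _

theorem relativeModularGraph_eq (hρ : IsSpectralDecomposition ρ r u)
    (hσ : IsSpectralDecomposition σ s v) :
    relativeModularGraph ρ σ = diagonalGraph (rankOneBasis u v) (fun a => r a.1 / s a.2) := by
  have hl : ∀ i j, 0 ≤ r i / s j := fun i j => div_nonneg (hρ.nonneg i) (hσ.nonneg j)
  have hll : ∀ i j, ((√(r i / s j) : ℝ) : ℂ) * (√(r i / s j) : ℝ) = ((r i / s j : ℝ) : ℂ) :=
    fun i j => by rw [← Complex.ofReal_mul, Real.mul_self_sqrt (hl i j)]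
  ext ⟨x, y⟩
  constructor
  · rintro ⟨b, hb, hy⟩ ⟨i, j⟩
    have h1 := inner_snd_of_mem_closure_graphS hρ hσ hb i j
    -- The adjoint relation is tested on the single basis vector `|uᵢ⟩⟨vⱼ|`.
    have h2 := hy _ (smul_rankOneHS_mem_graphS hρ hσ i j 1)
    simp only [map_one, mul_one, one_smul, inner_smul_right] at h1 h2
    rw [inner_conj_symm, ← inner_conj_symm b, h1] at h2
    simp only [rankOneBasis_apply, ← h2, map_mul, Complex.conj_ofReal, Complex.conj_conj]
    rw [← hll, mul_assoc]
  · intro h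
    -- These are the coefficients that `b = S̄ x` must have. They are square-summable since `λ ≤ 1 +
    -- λ²` bounds `λ |xₐ|²` by `|xₐ|² + |λ xₐ|²`, and `λ xₐ` is the coefficient of `y`.
    have hs : Summable fun q : ι × ι => ‖((√(r q.2 / s q.1) : ℝ) : ℂ) *
        starRingEnd ℂ ⟪rankOneHS (u q.2) (v q.1), x⟫_ℂ‖ ^ 2 := by
      rw [← (Equiv.prodComm ι ι).summable_iff]
      refine Summable.of_nonneg_of_le (fun a => sq_nonneg _) (fun a => ?_)
        ((summable_norm_inner_sq (rankOneBasis u v) x).add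
          (summable_norm_inner_sq (rankOneBasis u v) y))
      have ha := h a
      simp only [rankOneBasis_apply] at ha
      simp only [Function.comp_apply, Equiv.prodComm_apply, Prod.fst_swap, Prod.snd_swap,
        rankOneBasis_apply, ha, norm_mul, mul_pow, Complex.norm_real, RCLike.norm_conj,
        Real.norm_eq_abs, sq_abs, Real.sq_sqrt (hl _ _)]
      set N := ‖⟪rankOneHS (u a.1) (v a.2), x⟫_ℂ‖ ^ 2 with hN
      have hN0 : 0 ≤ N := by positivity
      nlinarith [mul_nonneg hN0 (sq_nonneg (r a.1 / s a.2 - 1)), mul_nonneg hN0 (hl a.1 a.2)]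
    obtain ⟨b, hb⟩ := exists_inner_eq (rankOneBasis v u) hs
    have hb' : ∀ i j, ⟪rankOneHS (v j) (u i), b⟫_ℂ =
        √(r i / s j) * starRingEnd ℂ ⟪rankOneHS (u i) (v j), x⟫_ℂ := fun i j => by
      rw [← hb (j, i), rankOneBasis_apply]
    refine ⟨b, mem_closure_graphS hρ hσ hb', fun p hp => ?_⟩
    have h1 := (rankOneBasis v u).hasSum_inner_mul_inner b p.2
    rw [← (Equiv.prodComm ι ι).hasSum_iff] at h1
    have h2 := (rankOneBasis u v).hasSum_inner_mul_inner p.1 y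
    change ⟪b, p.2⟫_ℂ = starRingEnd ℂ ⟪y, p.1⟫_ℂ
    rw [inner_conj_symm]
    refine h1.unique (h2.congr_fun fun a => ?_)
    simp only [Function.comp_apply, Equiv.prodComm_apply, rankOneBasis_apply, Prod.fst_swap,
      Prod.snd_swap]
    rw [inner_snd_of_mem_graphS hρ hσ hp, ← inner_conj_symm b, hb', ← inner_conj_symm p.1]
    have ha := h a
    simp only [rankOneBasis_apply] at ha
    rw [ha, ← hll]
    simp only [map_mul, Complex.conj_ofReal, Complex.conj_conj]
    ring

/-- The spectral measure of the relative modular operator in the vector `√σ`. -/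
theorem scalarMeasure_relativeModularGraph (hρ : IsSpectralDecomposition ρ r u)
    (hσ : IsSpectralDecomposition σ s v) :
    (spectralMeasure (relativeModularGraph ρ σ)).scalarMeasure σ.sqrtHS =
      Measure.sum fun a : ι × ι =>
        ENNReal.ofReal (nussbaumSzkolaQ s u v a) • Measure.dirac (r a.1 / s a.2) := by
  rw [relativeModularGraph_eq hρ hσ, scalarMeasure_spectralMeasure_diagonalGraph]
  congr 1
  funext a
  have h : ⟪rankOneBasis u v a, σ.sqrtHS⟫_ℂ = (√(s a.2) : ℂ) * ⟪u a.1, v a.2⟫_ℂ := by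
    rw [inner_rankOneBasis]
    change ⟪u a.1, σ.sqrt (v a.2)⟫_ℂ = _
    rw [hσ.sqrt_apply, inner_smul_right]
  rw [h, norm_mul, mul_pow, Complex.norm_real, Real.norm_eq_abs, sq_abs,
    Real.sq_sqrt (hσ.nonneg _)]
  rfl

/-- The trace `tr(σ Π)` for a projection `Π` that is diagonal in the basis `u`. -/
theorem hasSum_trace_mul_kerProj (hρ : IsSpectralDecomposition ρ r u)
    (hσ : IsSpectralDecomposition σ s v) :
    HasSum (fun a : ι × ι => if r a.1 = 0 then s a.2 * ‖⟪u a.1, v a.2⟫_ℂ‖ ^ 2 else 0)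
      (trace (σ.op * ρ.kerProj)).re := by
  let B : HilbertSchmidt K :=
    ⟨σ.sqrt * ρ.kerProj, mul_mem_hilbertSchmidtSubmodule_right _ σ.sqrt_mem⟩
  -- Written as `⟨√σ, √σ Π⟩₂`, the trace can be expanded by Parseval in the basis `|vⱼ⟩⟨uᵢ|`.
  have ht : trace (σ.op * ρ.kerProj) = ⟪σ.sqrtHS, B⟫_ℂ := by
    rw [HilbertSchmidt.inner_def, trace]
    refine tsum_congr fun i => ?_
    change _ = ⟪σ.sqrt _, σ.sqrt (ρ.kerProj _)⟫_ℂ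
    rw [inner_apply_comm_of_isSelfAdjoint σ.isSelfAdjoint_sqrt, σ.sqrt_sqrt_apply]
    rfl
  have h1 := Complex.hasSum_re ((rankOneBasis v u).hasSum_inner_mul_inner σ.sqrtHS B)
  rw [← ht, ← (Equiv.prodComm ι ι).hasSum_iff] at h1
  refine h1.congr_fun fun a => ?_
  simp only [Function.comp_apply, Equiv.prodComm_apply]
  rw [← inner_conj_symm σ.sqrtHS, inner_rankOneBasis, inner_rankOneBasis]
  change _ = (starRingEnd ℂ ⟪v a.2, σ.sqrt (u a.1)⟫_ℂ * ⟪v a.2, σ.sqrt (ρ.kerProj (u a.1))⟫_ℂ).re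
  rw [hρ.kerProj_apply]
  split_ifs with h0
  · rw [← Complex.normSq_eq_conj_mul_self, Complex.ofReal_re, Complex.normSq_eq_norm_sq,
      ← inner_apply_comm_of_isSelfAdjoint σ.isSelfAdjoint_sqrt, hσ.sqrt_apply, inner_smul_left,
      norm_mul, mul_pow, RCLike.norm_conj, Complex.norm_real, Real.norm_eq_abs, sq_abs,
      Real.sq_sqrt (hσ.nonneg _), norm_inner_symm]
  · simp

end ModularOperator

/-! ### Boundary behaviour of convex functions on `(0, ∞)` -/

section Convex

/-- Used to recover limits of `f t` and `f t / t` from those of monotone secant slopes, which may be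
infinite. A nonzero finite `y` and a finite `x` keep the product and the sum continuous at the
limit. -/
theorem exists_tendsto_coe_add_mul {l : Filter ℝ} {a b g : ℝ → ℝ} {x y : ℝ} {L : EReal}
    (ha : Tendsto a l (𝓝 x)) (hb : Tendsto b l (𝓝 y)) (hy : y ≠ 0)
    (hg : Tendsto (fun t => (g t : EReal)) l (𝓝 L)) :
    ∃ M : EReal, Tendsto (fun t => ((a t + b t * g t : ℝ) : EReal)) l (𝓝 M) := by
  have ha' : Tendsto (fun t => (a t : EReal)) l (𝓝 (x : EReal)) := EReal.tendsto_coe.2 ha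
  have hb' : Tendsto (fun t => (b t : EReal)) l (𝓝 (y : EReal)) := EReal.tendsto_coe.2 hb
  have hy' : (y : EReal) ≠ 0 := by simpa using hy
  have hm := EReal.Tendsto.mul hb' hg (Or.inl hy') (Or.inl hy') (Or.inl (EReal.coe_ne_bot y))
    (Or.inl (EReal.coe_ne_top y))
  have hs := (EReal.continuousAt_add (p := ((x : EReal), (y : EReal) * L))
    (Or.inl (EReal.coe_ne_top x)) (Or.inl (EReal.coe_ne_bot x))).tendsto.comp (ha'.prodMk_nhds hm)
  refine ⟨_, hs.congr fun t => ?_⟩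
  simp only [Function.comp_apply, EReal.coe_add, EReal.coe_mul]

variable {f : ℝ → ℝ}

/-- A convex function lies above its secant lines outside the interval they span: the line through
`1` and `2` bounds `f` on `t < 1`, the line through `1/2` and `1` on `t > 1`. -/
theorem exists_lower_bound_of_convexOn (hf : ConvexOn ℝ (Ioi 0) f) :
    ∃ C : ℝ, 0 ≤ C ∧ ∀ t, 0 < t → -f t ≤ C * (1 + t) := by
  set m := (f 2 - f 1) / (2 - 1) with hm
  set m' := (f (1 / 2) - f 1) / (1 / 2 - 1) with hm'
  refine ⟨|f 1| + |m| + |m'|, by positivity, fun t ht => ?_⟩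
  have h1 : (1 : ℝ) ∈ Ioi (0 : ℝ) := by simp
  have hb : -f 1 ≤ |f 1| := neg_le_abs _
  have a1 := abs_nonneg (f 1)
  have a2 := abs_nonneg m
  have a3 := abs_nonneg m'
  have key : ∀ c : ℝ, c * (t - 1) ≤ f t - f 1 → |c| ≤ |m| + |m'| →
      -f t ≤ (|f 1| + |m| + |m'|) * (1 + t) := by
    intro c hc hcm
    have h2 : -(c * (t - 1)) ≤ |c| * (1 + t) := by
      have h3 : |t - 1| ≤ 1 + t := abs_le.2 ⟨by linarith, by linarith⟩
      calc -(c * (t - 1)) ≤ |c * (t - 1)| := neg_le_abs _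
        _ = |c| * |t - 1| := abs_mul _ _
        _ ≤ |c| * (1 + t) := by gcongr
    nlinarith [mul_nonneg a1 ht.le, mul_le_mul_of_nonneg_right hcm (by linarith : 0 ≤ 1 + t)]
  rcases lt_trichotomy t 1 with h | h | h
  · have h4 := hf.secant_mono h1 (mem_Ioi.2 ht) (by norm_num : (2 : ℝ) ∈ Ioi (0 : ℝ)) h.ne
      (by norm_num) (by linarith)
    rw [div_le_iff_of_neg (by linarith), ← hm] at h4
    exact key m h4 (by linarith)
  · subst h
    nlinarith
  · have h4 := hf.secant_mono h1 (by norm_num : (1 / 2 : ℝ) ∈ Ioi (0 : ℝ)) (mem_Ioi.2 ht)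
      (by norm_num) h.ne' (by linarith)
    rw [le_div_iff₀ (by linarith), ← hm'] at h4
    exact key m' h4 (by linarith)

theorem exists_tendsto_zero_of_convexOn (hf : ConvexOn ℝ (Ioi 0) f) :
    ∃ L : EReal, L ≠ ⊥ ∧ Tendsto (fun t => (f t : EReal)) (𝓝[>] 0) (𝓝 L) := by
  have hmono : MonotoneOn (fun t => (((f t - f 1) / (t - 1) : ℝ) : EReal)) (Ioo 0 1) :=
    fun x hx y hy hxy => EReal.coe_le_coe_iff.2
      (hf.secant_mono (by simp) hx.1 hy.1 hx.2.ne hy.2.ne hxy)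
  have hg := hmono.tendsto_nhdsWithin_Ioo_right (nonempty_Ioo.2 zero_lt_one) (OrderBot.bddBelow _)
  have ht : Tendsto (fun t : ℝ => t - 1) (𝓝[>] 0) (𝓝 (0 - 1)) :=
    ((continuous_id.sub continuous_const).tendsto 0).mono_left nhdsWithin_le_nhds
  obtain ⟨L, hL⟩ := exists_tendsto_coe_add_mul (tendsto_const_nhds (x := f 1)) ht (by norm_num) hg
  have hIoo : Ioo (0 : ℝ) 1 ∈ 𝓝[>] (0 : ℝ) := Ioo_mem_nhdsGT zero_lt_one
  have hL' : Tendsto (fun t => (f t : EReal)) (𝓝[>] 0) (𝓝 L) := by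
    refine hL.congr' ?_
    filter_upwards [hIoo] with t ht
    have : t - 1 ≠ 0 := by linarith [ht.2]
    rw [mul_div_cancel₀ _ this, add_sub_cancel]
  obtain ⟨C, hC, hCf⟩ := exists_lower_bound_of_convexOn hf
  refine ⟨L, fun hbot => ?_, hL'⟩
  have h := ge_of_tendsto hL' (b := ((-(C * 2) : ℝ) : EReal)) (by
    filter_upwards [hIoo] with t ht
    rw [EReal.coe_le_coe_iff]
    nlinarith [hCf t ht.1, ht.2])
  rw [hbot, le_bot_iff] at h
  exact EReal.coe_ne_bot _ h

theorem exists_tendsto_slope_of_convexOn (hf : ConvexOn ℝ (Ioi 0) f) :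
    ∃ L : EReal, L ≠ ⊥ ∧ Tendsto (fun t : ℝ => ((f t / t : ℝ) : EReal)) atTop (𝓝 L) := by
  -- Truncation at `2` makes the slope from `1` monotone on all of `ℝ` without changing it near
  -- infinity.
  have hmono : Monotone
      (fun t : ℝ => (((f (max t 2) - f 1) / (max t 2 - 1) : ℝ) : EReal)) := fun x y hxy => by
    have h2 : ∀ z : ℝ, (2 : ℝ) ≤ max z 2 := fun z => le_max_right _ _
    exact EReal.coe_le_coe_iff.2 (hf.secant_mono (by simp)
      (mem_Ioi.2 (by linarith [h2 x])) (mem_Ioi.2 (by linarith [h2 y]))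
      (by linarith [h2 x]) (by linarith [h2 y]) (max_le_max_right 2 hxy))
  have hg := tendsto_atTop_iSup hmono
  have hinv : Tendsto (fun t : ℝ => t⁻¹) atTop (𝓝 0) := tendsto_inv_atTop_zero
  obtain ⟨L, hL⟩ := exists_tendsto_coe_add_mul (hinv.const_mul (f 1)) (hinv.const_sub 1)
    (by norm_num) hg
  have hL' : Tendsto (fun t : ℝ => ((f t / t : ℝ) : EReal)) atTop (𝓝 L) := by
    refine hL.congr' ?_
    filter_upwards [eventually_ge_atTop 2] with t ht
    have h1 : t - 1 ≠ 0 := by linarith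
    have h2 : t ≠ 0 := by linarith
    rw [max_eq_left ht]
    congr 1
    field_simp
    ring
  obtain ⟨C, hC, hCf⟩ := exists_lower_bound_of_convexOn hf
  refine ⟨L, fun hbot => ?_, hL'⟩
  have h := ge_of_tendsto hL' (b := ((-(C * 2) : ℝ) : EReal)) (by
    filter_upwards [eventually_ge_atTop 1] with t ht
    have ht0 : 0 < t := by linarith
    rw [EReal.coe_le_coe_iff, le_div_iff₀ ht0]
    nlinarith [hCf t ht0])
  rw [hbot, le_bot_iff] at h
  exact EReal.coe_ne_bot _ h

theorem valueAtZero_ne_bot (hf : ConvexOn ℝ (Ioi 0) f) : valueAtZero f ≠ ⊥ := by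
  obtain ⟨L, h, hL⟩ := exists_tendsto_zero_of_convexOn hf
  rwa [valueAtZero, hL.limUnder_eq]

theorem slopeAtInfty_ne_bot (hf : ConvexOn ℝ (Ioi 0) f) : slopeAtInfty f ≠ ⊥ := by
  obtain ⟨L, h, hL⟩ := exists_tendsto_slope_of_convexOn hf
  rwa [slopeAtInfty, hL.limUnder_eq]

theorem valueAtZero_ne_top (hf : ConcaveOn ℝ (Ioi 0) f) : valueAtZero f ≠ ⊤ := by
  obtain ⟨L, h, hL⟩ := exists_tendsto_zero_of_convexOn hf.neg
  have h1 : Tendsto (fun t => (f t : EReal)) (𝓝[>] 0) (𝓝 (-L)) :=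
    ((continuous_neg.tendsto L).comp hL).congr fun t => by simp
  rw [valueAtZero, h1.limUnder_eq]
  simpa using h

theorem slopeAtInfty_ne_top (hf : ConcaveOn ℝ (Ioi 0) f) : slopeAtInfty f ≠ ⊤ := by
  obtain ⟨L, h, hL⟩ := exists_tendsto_slope_of_convexOn hf.neg
  have h1 : Tendsto (fun t : ℝ => ((f t / t : ℝ) : EReal)) atTop (𝓝 (-L)) :=
    ((continuous_neg.tendsto L).comp hL).congr fun t => by
      simp only [Function.comp_apply, Pi.neg_apply, neg_div, EReal.coe_neg, neg_neg]
  rw [slopeAtInfty, h1.limUnder_eq]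
  simpa using h

end Convex

/-! ### Sums of extended reals -/

section EReal

/-- The finiteness hypothesis rules out `∞ - ∞`, where subtraction in `EReal` is not additive. -/
theorem coe_ennreal_sub_add_sub {p p' n n' : ℝ≥0∞}
    (h : (n ≠ ∞ ∧ n' ≠ ∞) ∨ (p ≠ ∞ ∧ p' ≠ ∞)) :
    ((p + p' : ℝ≥0∞) : EReal) - ((n + n' : ℝ≥0∞) : EReal) =
      ((p : EReal) - (n : EReal)) + ((p' : EReal) - (n' : EReal)) := by
  rcases h with ⟨h, h'⟩ | ⟨h, h'⟩
  · lift n to NNReal using h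
    lift n' to NNReal using h'
    induction p <;> induction p' <;>
      simp [EReal.coe_nnreal_eq_coe_real, ← EReal.coe_add, sub_eq_add_neg,
        ← EReal.coe_neg]
    ring
  · lift p to NNReal using h
    lift p' to NNReal using h'
    induction n <;> induction n' <;>
      simp [EReal.coe_nnreal_eq_coe_real, ← EReal.coe_add, sub_eq_add_neg,
        ← EReal.coe_neg]
    ring

variable {α : Type*}

/-- The constant may be `±∞`; its sign makes one of the two parts vanish, and `0 · ∞ = 0` covers
zero weights. -/
theorem erealSum_mul_const {w : α → ℝ} {W : ℝ} (hw : ∀ a, 0 ≤ w a) (hW : HasSum w W) (c : EReal) :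
    erealSum (fun a => (w a : EReal) * c) = c * W := by
  have hW0 : 0 ≤ W := hW.nonneg hw
  have hsum : ∑' a, ENNReal.ofReal (w a) = ENNReal.ofReal W := by
    rw [← hW.tsum_eq]
    exact (ENNReal.ofReal_tsum_of_nonneg hw hW.summable).symm
  have hpart : ∀ d : EReal, ∑' a, ((w a : EReal) * d).toENNReal =
      ENNReal.ofReal W * d.toENNReal := fun d => by
    rw [← hsum, ← ENNReal.tsum_mul_right]
    exact tsum_congr fun a => by
      rw [EReal.toENNReal_mul (EReal.coe_nonneg.2 (hw a)), EReal.real_coe_toENNReal]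
  have hneg : ∀ a, -((w a : EReal) * c) = (w a : EReal) * -c := fun a => (mul_neg _ _).symm
  have hWc : ((ENNReal.ofReal W : ℝ≥0∞) : EReal) = (W : EReal) := by
    rw [EReal.coe_ennreal_ofReal, max_eq_left hW0]
  simp only [erealSum, hneg, hpart, EReal.coe_ennreal_mul, hWc]
  rcases le_total 0 c with hc | hc
  · rw [EReal.coe_toENNReal hc, EReal.toENNReal_of_nonpos (by simpa using hc)]
    simp [mul_comm]
  · have hc' : 0 ≤ -c := by simpa using hc
    rw [EReal.coe_toENNReal hc', EReal.toENNReal_of_nonpos hc]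
    simp [mul_comm]

theorem tsum_toENNReal_mul_const_ne_top {w : α → ℝ} (hw : ∀ a, 0 ≤ w a) (hW : Summable w)
    {c : EReal} (hc : c ≠ ⊤) : ∑' a, ((w a : EReal) * c).toENNReal ≠ ∞ := by
  have h : ∀ a, ((w a : EReal) * c).toENNReal = ENNReal.ofReal (w a) * c.toENNReal := fun a => by
    rw [EReal.toENNReal_mul (EReal.coe_nonneg.2 (hw a)), EReal.real_coe_toENNReal]
  simp only [h, ENNReal.tsum_mul_right]
  exact ENNReal.mul_ne_top hW.tsum_ofReal_ne_top (EReal.toENNReal_ne_top_iff.2 hc)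

/-- The sum of three families with pairwise disjoint supports. -/
theorem erealSum_eq_add_add {g g₁ g₂ g₃ : α → EReal}
    (hg : ∀ a, (g a = g₁ a ∧ g₂ a = 0 ∧ g₃ a = 0) ∨ (g₁ a = 0 ∧ g a = g₂ a ∧ g₃ a = 0) ∨
      (g₁ a = 0 ∧ g₂ a = 0 ∧ g a = g₃ a))
    (hfin : (∑' a, (-g₁ a).toENNReal ≠ ∞ ∧ ∑' a, (-g₂ a).toENNReal ≠ ∞ ∧
        ∑' a, (-g₃ a).toENNReal ≠ ∞) ∨
      (∑' a, (g₁ a).toENNReal ≠ ∞ ∧ ∑' a, (g₂ a).toENNReal ≠ ∞ ∧ ∑' a, (g₃ a).toENNReal ≠ ∞)) :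
    erealSum g = erealSum g₁ + erealSum g₂ + erealSum g₃ := by
  have hp : ∑' a, (g a).toENNReal = ∑' a, (g₁ a).toENNReal + ∑' a, (g₂ a).toENNReal +
      ∑' a, (g₃ a).toENNReal := by
    rw [← ENNReal.tsum_add, ← ENNReal.tsum_add]
    refine tsum_congr fun a => ?_
    rcases hg a with ⟨h1, h2, h3⟩ | ⟨h1, h2, h3⟩ | ⟨h1, h2, h3⟩ <;> simp [h1, h2, h3]
  have hn : ∑' a, (-g a).toENNReal = ∑' a, (-g₁ a).toENNReal + ∑' a, (-g₂ a).toENNReal +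
      ∑' a, (-g₃ a).toENNReal := by
    rw [← ENNReal.tsum_add, ← ENNReal.tsum_add]
    refine tsum_congr fun a => ?_
    rcases hg a with ⟨h1, h2, h3⟩ | ⟨h1, h2, h3⟩ | ⟨h1, h2, h3⟩ <;> simp [h1, h2, h3]
  simp only [erealSum, hp, hn]
  rcases hfin with ⟨h1, h2, h3⟩ | ⟨h1, h2, h3⟩
  · rw [coe_ennreal_sub_add_sub (Or.inl ⟨ENNReal.add_ne_top.2 ⟨h1, h2⟩, h3⟩),
      coe_ennreal_sub_add_sub (Or.inl ⟨h1, h2⟩)]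
  · rw [coe_ennreal_sub_add_sub (Or.inr ⟨ENNReal.add_ne_top.2 ⟨h1, h2⟩, h3⟩),
      coe_ennreal_sub_add_sub (Or.inr ⟨h1, h2⟩)]

/-- Integrals over `(0, ∞)` with respect to a sum of point masses. -/
theorem erealIntegral_sum_dirac {q l : α → ℝ} (hq : ∀ a, 0 ≤ q a) (g : ℝ → EReal) :
    erealIntegral ((Measure.sum fun a => ENNReal.ofReal (q a) • Measure.dirac (l a)).restrict
      (Ioi 0)) g = erealSum (fun a => if 0 < l a then (q a : EReal) * g (l a) else 0) := by
  have h : ∀ k : ℝ → EReal, ∫⁻ t, (k t).toENNReal ∂((Measure.sum fun a =>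
      ENNReal.ofReal (q a) • Measure.dirac (l a)).restrict (Ioi 0)) =
      ∑' a, (if 0 < l a then (q a : EReal) * k (l a) else 0).toENNReal := fun k => by
    rw [← lintegral_indicator measurableSet_Ioi, lintegral_sum_measure]
    refine tsum_congr fun a => ?_
    rw [lintegral_smul_measure, lintegral_dirac, smul_eq_mul]
    split_ifs with ha
    · rw [indicator_of_mem (mem_Ioi.2 ha), EReal.toENNReal_mul (EReal.coe_nonneg.2 (hq a)),
        EReal.real_coe_toENNReal]
    · rw [indicator_of_notMem (by simpa using ha)]
      simp
  have hneg : ∀ a, -(if 0 < l a then (q a : EReal) * g (l a) else 0) =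
      if 0 < l a then (q a : EReal) * -g (l a) else 0 := fun a => by
    split_ifs
    · rw [mul_neg]
    · simp
  simp only [erealIntegral, erealSum, hneg]
  rw [h g, h fun t => -g t]

/-- A sum `∑ q g(p / q)⁺` is finite if `g` has at most linear growth. -/
theorem tsum_toENNReal_ne_top_of_le {p q l : α → ℝ} (hq : ∀ a, 0 ≤ q a)
    (hps : Summable p) (hqs : Summable q) (hl : ∀ a, 0 < l a → q a * l a = p a)
    {g : ℝ → ℝ} {C : ℝ} (hg : ∀ t, 0 < t → g t ≤ C * (1 + t)) :
    ∑' a, (if 0 < l a then (q a : EReal) * (g (l a) : EReal) else 0).toENNReal ≠ ∞ := by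
  refine ne_top_of_le_ne_top ((hqs.add hps).mul_left C).tsum_ofReal_ne_top
    (ENNReal.tsum_le_tsum fun a => ?_)
  split_ifs with ha
  · rw [← EReal.coe_mul, EReal.real_coe_toENNReal]
    refine ENNReal.ofReal_le_ofReal ?_
    calc q a * g (l a) ≤ q a * (C * (1 + l a)) := mul_le_mul_of_nonneg_left (hg _ ha) (hq a)
      _ = C * (q a + q a * l a) := by ring
      _ = C * (q a + p a) := by rw [hl a ha]
  · simp

end EReal

/-! ### The divergences -/

section Divergence

variable {K : Type*} [NormedAddCommGroup K] [InnerProductSpace ℂ K] {ι : Type*}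

theorem summable_nussbaumSzkolaP {r : ι → ℝ} (hr : ∀ i, 0 ≤ r i) (hs : Summable r)
    (u v : HilbertBasis ι ℂ K) : Summable (nussbaumSzkolaP r u v) := by
  have hv : ∀ i, HasSum (fun j => nussbaumSzkolaP r u v (i, j)) (r i) := fun i => by
    have h := (hasSum_norm_inner_sq v (u i)).mul_left (r i)
    rw [u.orthonormal.1 i, one_pow, mul_one] at h
    exact h.congr_fun fun j => by rw [nussbaumSzkolaP, norm_inner_symm]
  refine (summable_prod_of_nonneg fun a => mul_nonneg (hr _) (sq_nonneg _)).2
    ⟨fun i => (hv i).summable, ?_⟩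
  exact (summable_congr fun i => (hv i).tsum_eq).2 hs

theorem nussbaumSzkolaQ_eq_swap (s : ι → ℝ) (u v : HilbertBasis ι ℂ K) (a : ι × ι) :
    nussbaumSzkolaQ s u v a = nussbaumSzkolaP s v u a.swap := by
  rw [nussbaumSzkolaP, nussbaumSzkolaQ, Prod.fst_swap, Prod.snd_swap, norm_inner_symm]

theorem summable_nussbaumSzkolaQ {s : ι → ℝ} (hs : ∀ i, 0 ≤ s i) (hs' : Summable s)
    (u v : HilbertBasis ι ℂ K) : Summable (nussbaumSzkolaQ s u v) :=
  ((Equiv.prodComm ι ι).summable_iff.2 (summable_nussbaumSzkolaP hs hs' v u)).congr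
    fun a => (nussbaumSzkolaQ_eq_swap s u v a).symm

/-- At each index at most one of the three contributions survives, in the form required by
`erealSum_eq_add_add`. As `r / 0 = 0`, the test `0 < r / s` means that both are positive. -/
theorem divergenceTerm_cases (f : ℝ → ℝ) {r s w : ℝ} (hr : 0 ≤ r) (hs : 0 ≤ s) :
    (divergenceTerm f (r * w) (s * w) =
        (if 0 < r / s then ((s * w : ℝ) : EReal) * (f (r / s) : EReal) else 0) ∧
      (((if r = 0 then s * w else 0 : ℝ) : EReal) * valueAtZero f = 0) ∧
      (((if s = 0 then r * w else 0 : ℝ) : EReal) * slopeAtInfty f = 0)) ∨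
    ((if 0 < r / s then ((s * w : ℝ) : EReal) * (f (r / s) : EReal) else 0) = 0 ∧
      divergenceTerm f (r * w) (s * w) =
        ((if r = 0 then s * w else 0 : ℝ) : EReal) * valueAtZero f ∧
      (((if s = 0 then r * w else 0 : ℝ) : EReal) * slopeAtInfty f = 0)) ∨
    ((if 0 < r / s then ((s * w : ℝ) : EReal) * (f (r / s) : EReal) else 0) = 0 ∧
      (((if r = 0 then s * w else 0 : ℝ) : EReal) * valueAtZero f = 0) ∧
      divergenceTerm f (r * w) (s * w) =
        ((if s = 0 then r * w else 0 : ℝ) : EReal) * slopeAtInfty f) := by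
  by_cases hw : w = 0
  · left
    simp [hw, divergenceTerm]
  rcases hr.eq_or_lt with rfl | hr <;> rcases hs.eq_or_lt with rfl | hs
  · left
    simp [divergenceTerm]
  · right; left
    simp [divergenceTerm, hs.ne', hw]
  · right; right
    simp [divergenceTerm, hr.ne', hw]
  · left
    simp [divergenceTerm, hr.ne', hs.ne', hw, div_pos hr hs, mul_div_mul_right]

end Divergence

end NussbaumSzkola

end

theorem theorem3p4 {K : Type*} [NormedAddCommGroup K] [InnerProductSpace ℂ K] [CompleteSpace K]
    {ι : Type*} (ρ σ : NussbaumSzkola.DensityOperator K)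
    (r s : ι → ℝ) (u v : HilbertBasis ι ℂ K)
    (hρ : NussbaumSzkola.IsSpectralDecomposition ρ r u)
    (hσ : NussbaumSzkola.IsSpectralDecomposition σ s v)
    (f : ℝ → ℝ) (hf : ConvexOn ℝ (Set.Ioi 0) f ∨ ConcaveOn ℝ (Set.Ioi 0) f) :
    NussbaumSzkola.quantumFDivergence f ρ σ =
      NussbaumSzkola.classicalFDivergence f (NussbaumSzkola.nussbaumSzkolaP r u v)
        (NussbaumSzkola.nussbaumSzkolaQ s u v) := by
  open NussbaumSzkola in
  have hP0 : ∀ a, 0 ≤ nussbaumSzkolaP r u v a := fun a => mul_nonneg (hρ.nonneg _) (sq_nonneg _)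
  have hQ0 : ∀ a, 0 ≤ nussbaumSzkolaQ s u v a := fun a => mul_nonneg (hσ.nonneg _) (sq_nonneg _)
  have hP := summable_nussbaumSzkolaP hρ.nonneg hρ.hasSum_one.summable u v
  have hQ := summable_nussbaumSzkolaQ hσ.nonneg hσ.hasSum_one.summable u v
  have hB := hasSum_trace_mul_kerProj hρ hσ
  have hC : HasSum (fun a : ι × ι => if s a.2 = 0 then nussbaumSzkolaP r u v a else 0)
      (trace (ρ.op * σ.kerProj)).re := by
    have h := hasSum_trace_mul_kerProj hσ hρ
    rw [← (Equiv.prodComm ι ι).hasSum_iff] at h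
    refine h.congr_fun fun a => ?_
    simp only [Function.comp_apply, Equiv.prodComm_apply, Prod.fst_swap, Prod.snd_swap,
      nussbaumSzkolaP, norm_inner_symm (v a.2)]
  have hB0 : ∀ a : ι × ι, 0 ≤ if r a.1 = 0 then s a.2 * ‖inner ℂ (u a.1) (v a.2)‖ ^ 2 else 0 :=
    fun a => by split_ifs <;> [exact hQ0 a; exact le_rfl]
  have hC0 : ∀ a : ι × ι, 0 ≤ if s a.2 = 0 then nussbaumSzkolaP r u v a else 0 :=
    fun a => by split_ifs <;> [exact hP0 a; exact le_rfl]
  have hl : ∀ a : ι × ι, 0 < r a.1 / s a.2 →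
      nussbaumSzkolaQ s u v a * (r a.1 / s a.2) = nussbaumSzkolaP r u v a := fun a ha => by
    have hs : s a.2 ≠ 0 := fun h => by simp [h] at ha
    rw [nussbaumSzkolaP, nussbaumSzkolaQ]
    field_simp
  have hneg : ∀ a : ι × ι, -(if 0 < r a.1 / s a.2 then
      (nussbaumSzkolaQ s u v a : EReal) * (f (r a.1 / s a.2) : EReal) else 0) =
      if 0 < r a.1 / s a.2 then
        (nussbaumSzkolaQ s u v a : EReal) * ((-f (r a.1 / s a.2) : ℝ) : EReal) else 0 :=
    fun a => by
      split_ifs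
      · rw [EReal.coe_neg, mul_neg]
      · simp
  rw [quantumFDivergence, scalarMeasure_relativeModularGraph hρ hσ, erealIntegral_sum_dirac hQ0,
    ← erealSum_mul_const hB0 hB, ← erealSum_mul_const hC0 hC, classicalFDivergence]
  symm
  refine erealSum_eq_add_add
    (fun a => divergenceTerm_cases f (hρ.nonneg a.1) (hσ.nonneg a.2)) ?_
  -- Convexity controls the negative parts of all three families, concavity the positive parts.
  rcases hf with hf | hf
  · left
    obtain ⟨C, -, hC2⟩ := exists_lower_bound_of_convexOn hf
    refine ⟨?_, ?_, ?_⟩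
    · simp only [hneg]
      exact tsum_toENNReal_ne_top_of_le (g := fun t => -f t) hQ0 hP hQ hl hC2
    · simp only [← mul_neg]
      exact tsum_toENNReal_mul_const_ne_top hB0 hB.summable (by simpa using valueAtZero_ne_bot hf)
    · simp only [← mul_neg]
      exact tsum_toENNReal_mul_const_ne_top hC0 hC.summable (by simpa using slopeAtInfty_ne_bot hf)
  · right
    obtain ⟨C, -, hC2⟩ := exists_lower_bound_of_convexOn hf.neg
    simp only [Pi.neg_apply, neg_neg] at hC2
    exact ⟨tsum_toENNReal_ne_top_of_le hQ0 hP hQ hl hC2,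
      tsum_toENNReal_mul_const_ne_top hB0 hB.summable (valueAtZero_ne_top hf),
      tsum_toENNReal_mul_const_ne_top hC0 hC.summable (slopeAtInfty_ne_top hf)⟩
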